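/- **Model.** Let $N\ge 1$, $N_t,N_r\ge1$ with $N_tN_r\ge 2$, $d\ge 1$, $B\ge 0$ be integers and let $P,\zeta,\sigma,\tau,R,\theta>0$ be real numbers with $N\theta<1$. Put $Q=N_tN_r-1$, $\alpha=P\zeta/d$, $\breve a=\frac{(Q+1)d-1}{Q}$, $\breve b=(Q-1)\breve a$. There are $N$ transmitter-receiver pairs with $d$ streams each, and time is slotted. In each slot a set $S\subseteq\{1,\dots,N\}$ of active pairs is selected. The SINR of stream $m$ of an active user $k\in S$ is $$\gamma_k^{(m)}=\frac{\alpha\,G_k^{(m)}}{\sigma^2+\sum_{i\in S,\,i\ne k}\alpha\,\|h_{ki}\|^2 e_{ki}\,Z_{ki}^{(m)}} .$$ Here (for given $S$, $k\in S$ and $m$) the variables $G_k^{(m)}$ and $\|h_{ki}\|^2,\ e_{ki},\ Z_{ki}^{(m)}$ ($i\in S\setminus\{k\}$) are independent; $G_k^{(m)}$ (gain of the desired signal) is exponential with parameter $1$; $h_{ki}$ is a vector of $N_tN_r$ i.i.d. standard complex Gaussian entries; the quantization error $e_{ki}$ of the limited backhaul has distribution function $2^B\varepsilon^Q$ on $[0,2^{-B/Q}]$;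 and $Z_{ki}^{(m)}$ (residual interference factor) is distributed as $d$ times a $\mathrm{Beta}(\breve a,\breve b)$ variable, where $\mathrm{Beta}(\breve a,0)$ (case $Q=1$) means the unit mass at $1$. $G_k^{(m)}$ and $Z_{ki}^{(m)}$ may depend on $S$; the joint law is otherwise arbitrary. The fading is i.i.d. over slots. In a slot $t$ with active set $S$, user $k$ is served $B_k(t)=(1-|S|\theta)\sum_{m=1}^d R\,\mathbf 1\{\gamma_k^{(m)}\ge\tau\}$ bits if $k\in S$, and $B_k(t)=0$ otherwise. The arrivals $A(t)=(A_1(t),\dots,A_N(t))$ are i.i.d. in time, independent across users, nonnegative, bounded, and independent of the fading and of the scheduler's randomization; their mean vector is $\mathbf a=(a_1,\dots,a_N)$. The queues evolve by $q_k(t+1)=\max\{q_k(t)-B_k(t),0\}+A_k(t)$ from a deterministic $q(0)\in\mathbb R_+^N$. A centralized policy chooses the active set of slot $t$ as a measurable function of $q(t)$ and of a fresh random variable, uniform on $[0,1]$ and independent of everything else. The system is strongly stable if $\limsup_{T\to\infty}\frac1T\sum_{t=0}^{T-1}\mathbb E\,q_k(t)<\infty$ for all $k$. The stability region $\Lambda$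 is the set of $\mathbf a\in\mathbb R_+^N$ for which some centralized policy makes the system strongly stable for all arrival laws with mean $\mathbf a$ and all $q(0)\in\mathbb R_+^N$. **Rates.** Let $$r(L)=(1-L\theta)\,d\,R\,e^{-\sigma^2\tau/\alpha}F^{L-1},\qquad F=\Big(\frac{d\tau}{2^{B/Q}}+1\Big)^{-Q}{}_2F_1\Big(\breve b,Q;\breve a+\breve b;\frac{1}{\frac{2^{B/Q}}{d\tau}+1}\Big),$$ $I_L=\{r(L)\,\mathbf s:\mathbf s\in\{0,1\}^N,\ \|\mathbf s\|_1=L\}$ for integers $L\ge0$ (so $I_0=\{0\}$, and $I_L=\emptyset$ for $L>N$), and let $L_{\mathrm I}$ be an integer that maximizes the total average rate $L\,r(L)$ over the integers $L\ge0$. Let $\Lambda_{\mathrm I}=\mathcal{CH}\{I_0,I_1,\dots,I_{L_{\mathrm I}}\}$ be the (closed) convex hull of $I_0\cup I_1\cup\dots\cup I_{L_{\mathrm I}}$. **Theorem.** The stability region of the symmetric system with limited backhaul is $\Lambda_{\mathrm I}$, up to boundary points: 1. $\overline{\Lambda}=\Lambda_{\mathrm I}$; in particular $\Lambda\subseteq\Lambda_{\mathrm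 I}$. 2. Every point of the interior of $\Lambda_{\mathrm I}$ relative to $\mathbb R_+^N$ belongs to $\Lambda$. 3. If, for some arrival law with mean $\mathbf a$ and some $q(0)\in\mathbb R_+^N$, the system is strongly stable under some causal policy, that is, one whose active set in slot $t$ is a measurable function of everything that happened in the slots before $t$ and of a fresh randomization, then $\mathbf a\in\Lambda_{\mathrm I}$. -/

import Mathlib

open MeasureTheory ProbabilityTheory Topology Filter
open scoped ENNReal

noncomputable section

namespace SymIA

/-! ### Parameters and average rates -/

/-- Parameters of the symmetric `N`-pair MIMO interference network with limited backhaul. -/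
structure Params where
  /-- maximum number of transmitter-receiver pairs -/
  N : ℕ
  /-- antennas at each transmitter -/
  Nt : ℕ
  /-- antennas at each receiver -/
  Nr : ℕ
  /-- data streams per pair -/
  d : ℕ
  /-- quantization bits per channel matrix -/
  B : ℕ
  /-- total power at each transmitter -/
  P : ℝ
  /-- common path loss coefficient -/
  ζ : ℝ
  /-- noise standard deviation -/
  sigma : ℝ
  /-- SINR threshold -/
  τ : ℝ
  /-- bits per slot assigned to a stream whose SINR is at least the threshold -/
  R : ℝ
  /-- fraction of the slot needed to acquire the CSI of one user -/
  θ : ℝ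
  N_pos : 0 < N
  antennas : 2 ≤ Nt * Nr
  d_pos : 0 < d
  P_pos : 0 < P
  ζ_pos : 0 < ζ
  sigma_pos : 0 < sigma
  τ_pos : 0 < τ
  R_pos : 0 < R
  θ_pos : 0 < θ
  Nθ_lt_one : (N : ℝ) * θ < 1

namespace Params

variable (p : Params)

/-- `Q = N_t N_r - 1`, which is at least `1`. -/
def Q : ℕ := p.Nt * p.Nr - 1

/-- `α = P ζ / d`. -/
def α : ℝ := p.P * p.ζ / p.d

/-- The parameter `ă = (Q+1) d / Q - 1 / Q`. -/
def betaA : ℝ := ((p.Q : ℝ) + 1) * p.d / p.Q - 1 / p.Q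

/-- The parameter `b̆ = (Q-1) ă`. -/
def betaB : ℝ := ((p.Q : ℝ) - 1) * p.betaA

/-- `2 ^ (B / Q)`. -/
def δ : ℝ := (2 : ℝ) ^ ((p.B : ℝ) / (p.Q : ℝ))

/-- `F = (dτ / 2^(B/Q) + 1)^(-Q) ₂F₁(b̆, Q; ă + b̆; 1 / (2^(B/Q) / (dτ) + 1))`. -/
def F : ℝ :=
  (p.d * p.τ / p.δ + 1) ^ (-(p.Q : ℤ)) *
    ordinaryHypergeometric p.betaB (p.Q : ℝ) (p.betaA + p.betaB)
      (1 / (p.δ / (p.d * p.τ) + 1))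

/-- The average transmission rate `r(L) = (1 - Lθ) d R exp(-σ²τ/α) F^(L-1)` of an active user when
`L` pairs are active. -/
def r (L : ℕ) : ℝ :=
  (1 - L * p.θ) * p.d * p.R * Real.exp (-(p.sigma ^ 2 * p.τ / p.α)) * p.F ^ ((L : ℤ) - 1)

/-- The total average transmission rate `L r(L)`. -/
def rT (L : ℕ) : ℝ := L * p.r L

/-- `I_L = { r(L) s : s ∈ {0,1}^N, ‖s‖₁ = L }`; the vector `s` is the indicator of a set of `L`
pairs. -/
def ratePoints (L : ℕ) : Set (Fin p.N → ℝ) :=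
  {x | ∃ S : Finset (Fin p.N), S.card = L ∧ x = fun k => if k ∈ S then p.r L else 0}

/-- The convex hull of `I_0 = {0}, I_1, …, I_M`. It is the hull of a finite set, hence closed. -/
def rateHull (M : ℕ) : Set (Fin p.N → ℝ) :=
  convexHull ℝ (⋃ L ∈ Finset.range (M + 1), p.ratePoints L)

/-! ### Fading laws -/

/-- The standard circularly symmetric complex Gaussian law (zero mean, unit variance). -/
def complexGaussian : Measure ℂ :=
  ((gaussianReal 0 (1 / 2)).prod (gaussianReal 0 (1 / 2))).map (fun z => (⟨z.1, z.2⟩ : ℂ))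

/-- The law of `‖h‖²`, where `h` is the vectorization of an `N_r × N_t` matrix with i.i.d. standard
complex Gaussian entries. -/
def normSqLaw : Measure ℝ :=
  (Measure.pi (fun _ : Fin p.Nr × Fin p.Nt => complexGaussian)).map
    (fun h => ∑ i, ‖h i‖ ^ 2)

/-- The law of the quantization error: its distribution function is `2^B ε^Q` for
`0 ≤ ε ≤ 2^(-B/Q)`, that is, it has density `2^B Q ε^(Q-1)` on this interval. -/
def quantErrLaw : Measure ℝ :=
  (volume.restrict (Set.Icc 0 (p.δ)⁻¹)).withDensity
    (fun ε => ENNReal.ofReal (2 ^ p.B * p.Q * ε ^ (p.Q - 1)))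

/-- The law of the residual leakage factor `∑_j |w^H T^(j)|²` of an interferer: `d` times a
`Beta(ă, b̆)` variable, where `Beta(ă, 0)`, which occurs only for `Q = 1`, is the unit mass
at `1`. -/
def leakLaw : Measure ℝ :=
  (if p.Q = 1 then Measure.dirac 1 else betaMeasure p.betaA p.betaB).map (fun y => p.d * y)

end Params

/-- A model of the fading in one slot: random variables on a probability space `(H, law)`. The
variables `gain` and `leak` may depend on the set `S` of active pairs, since the combiners and
precoders do. The joint law is left free except for what one SINR involves. -/
structure Fading (p : Params) (H : Type*) [MeasurableSpace H] where
  law : Measure H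
  isProb : IsProbabilityMeasure law
  /-- `gain S k m` is `|u^H H_kk v|²` for stream `m` of user `k` -/
  gain : Finset (Fin p.N) → Fin p.N → Fin p.d → H → ℝ
  /-- `normSq k i` is `‖h_ki‖²` -/
  normSq : Fin p.N → Fin p.N → H → ℝ
  /-- `err k i` is the quantization error `e_ki` -/
  err : Fin p.N → Fin p.N → H → ℝ
  /-- `leak S k i m` is `∑_j |w_ki^H T_ki^(m,j)|²` -/
  leak : Finset (Fin p.N) → Fin p.N → Fin p.N → Fin p.d → H → ℝ
  measurable_gain : ∀ S k m, Measurable (gain S k m)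
  measurable_normSq : ∀ k i, Measurable (normSq k i)
  measurable_err : ∀ k i, Measurable (err k i)
  measurable_leak : ∀ S k i m, Measurable (leak S k i m)
  /-- For each stream of an active user, the gain of the desired signal and the three factors of
  the residual interference from each other active transmitter are independent, with the laws
  `Exp(1)`, `normSqLaw`, `quantErrLaw` and `leakLaw`. -/
  hasLaw : ∀ S, ∀ k ∈ S, ∀ m,
    HasLaw
      (fun h => (gain S k m h,
        fun i : {i // i ∈ S.erase k} => (normSq k i h, err k i h, leak S k i m h)))
      ((expMeasure 1).prod
        (Measure.pi fun _ : {i // i ∈ S.erase k} =>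
          p.normSqLaw.prod (p.quantErrLaw.prod p.leakLaw)))
      law

namespace Fading

variable {p : Params} {H : Type*} [MeasurableSpace H] (c : Fading p H)

/-- SINR of stream `m` at active user `k` when the pairs in `S` are active. -/
def sinr (S : Finset (Fin p.N)) (k : Fin p.N) (m : Fin p.d) (h : H) : ℝ :=
  p.α * c.gain S k m h /
    (p.sigma ^ 2 + ∑ i ∈ S.erase k, p.α * c.normSq k i h * c.err k i h * c.leak S k i m h)

open Classical in
/-- The number of bits served for user `k` in a slot with active set `S` and fading state `h`:
`(1 - |S|θ)` times the sum of the rates assigned to the streams, and `0` if `k` is not active. -/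
def service (S : Finset (Fin p.N)) (h : H) (k : Fin p.N) : ℝ :=
  if k ∈ S then
    (1 - S.card * p.θ) * ∑ m : Fin p.d, (if p.τ ≤ c.sinr S k m h then p.R else 0)
  else 0

end Fading

/-! ### Arrivals, slots and queues -/

/-- The law of the arrivals in one slot: nonnegative and bounded, independent across users. -/
structure Arrivals (N : ℕ) where
  law : Fin N → Measure ℝ
  isProb : ∀ k, IsProbabilityMeasure (law k)
  bounded : ∃ Amax : ℝ, ∀ k, ∀ᵐ x ∂(law k), 0 ≤ x ∧ x < Amax

/-- The vector of mean arrival rates. -/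
def Arrivals.mean {N : ℕ} (a : Arrivals N) (k : Fin N) : ℝ := ∫ x, x ∂(a.law k)

/-- What happens in one slot: the arrivals, the fading state and the coin of the scheduler. -/
abbrev Slot (p : Params) (H : Type*) := (Fin p.N → ℝ) × H × unitInterval

section Dynamics

variable {p : Params} {H : Type*} [MeasurableSpace H]

/-- The law of one slot. -/
def slotLaw (c : Fading p H) (a : Arrivals p.N) : Measure (Slot p H) :=
  (Measure.pi a.law).prod (c.law.prod (volume : Measure unitInterval))

instance (c : Fading p H) (a : Arrivals p.N) : IsProbabilityMeasure (slotLaw c a) := by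
  have := c.isProb
  have := a.isProb
  unfold slotLaw
  infer_instance

/-- The law of the whole evolution: the slots are i.i.d. -/
def pathLaw (c : Fading p H) (a : Arrivals p.N) : Measure (ℕ → Slot p H) :=
  Measure.infinitePi (fun _ : ℕ => slotLaw c a)

/-- `q(t+1) = max (q(t) - B(t)) 0 + A(t)`, with the active set `S` in slot `t`. -/
def step (c : Fading p H) (q : Fin p.N → ℝ) (S : Finset (Fin p.N)) (x : Slot p H) :
    Fin p.N → ℝ :=
  fun k => max (q k - c.service S x.2.1 k) 0 + x.1 k

/-- A centralized scheduling policy: at the beginning of each slot the active set is chosen as a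
function of the current queue lengths and of a fresh coin (uniform on `[0,1]`). -/
structure Policy (p : Params) where
  choose : (Fin p.N → ℝ) → unitInterval → Finset (Fin p.N)
  measurable : ∀ S, MeasurableSet {x : (Fin p.N → ℝ) × unitInterval | choose x.1 x.2 = S}

/-- The queue lengths under a policy, started from `q0`. -/
def Policy.queue (π : Policy p) (c : Fading p H) (q0 : Fin p.N → ℝ) :
    ℕ → (ℕ → Slot p H) → Fin p.N → ℝ
  | 0, _ => q0
  | t + 1, ω =>
    step c (π.queue c q0 t ω) (π.choose (π.queue c q0 t ω) (ω t).2.2) (ω t)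

/-- An arbitrary causal scheduling policy: the active set in slot `t` may depend on everything that
happened in the slots before `t` and on a fresh coin. -/
structure CausalPolicy (p : Params) (H : Type*) [MeasurableSpace H] where
  choose : (t : ℕ) → (Fin t → Slot p H) → unitInterval → Finset (Fin p.N)
  measurable : ∀ t S, MeasurableSet {x : (Fin t → Slot p H) × unitInterval | choose t x.1 x.2 = S}

/-- The queue lengths under a causal policy, started from `q0`. -/
def CausalPolicy.queue (π : CausalPolicy p H) (c : Fading p H) (q0 : Fin p.N → ℝ) :
    ℕ → (ℕ → Slot p H) → Fin p.N → ℝ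
  | 0, _ => q0
  | t + 1, ω =>
    step c (π.queue c q0 t ω) (π.choose t (fun i => ω i) (ω t).2.2) (ω t)

/-- Strong stability: `limsup_T (1/T) ∑_{t<T} E q_k(t) < ∞` for every `k`. -/
def StronglyStable {Ω : Type*} [MeasurableSpace Ω] (μ : Measure Ω) {N : ℕ}
    (q : ℕ → Ω → Fin N → ℝ) : Prop :=
  ∀ k, limsup (fun T : ℕ =>
    (∑ t ∈ Finset.range T, ∫⁻ ω, ENNReal.ofReal (q t ω k) ∂μ) / (T : ℝ≥0∞)) atTop < ⊤

/-- The stability region: the mean arrival rate vectors for which some centralized policy makes all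
queues strongly stable, whatever the arrival law with this mean and the initial queue lengths. -/
def stabilityRegion (c : Fading p H) : Set (Fin p.N → ℝ) :=
  {a | 0 ≤ a ∧ ∃ π : Policy p, ∀ A : Arrivals p.N, A.mean = a → ∀ q0 : Fin p.N → ℝ, 0 ≤ q0 →
    StronglyStable (pathLaw c A) (π.queue c q0)}

end Dynamics

end SymIA

end

namespace SymIA

/-! ### Laplace transforms and moments -/

/-! Only the mean service vector of each active set matters. Given the interference, the SINR of a
stream exceeds `τ` when an `Exp(1)` gain exceeds an affine function of the interference, so the
success probability is `exp(-σ²τ/α)` times one factor `E exp(-τ ‖h‖² e Z)` per interferer. Averaging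
over `‖h‖²` (a Gamma law), then over `e`, gives `(1 + τZ/δ)^(-Q)`, and Euler's integral over the
Beta law of `Z` gives `F` (`lintegral_exp_interfererLaw`). Hence an active set `S` has mean service
`r(|S|)` on `S` and `0` elsewhere (`Fading.lintegral_service`); by linearity the dependence between
streams and users plays no role.

Since `0 < F ≤ 1`, `r` decreases with the number of active users, and this makes the hull closed
under lowering coordinates (`mem_rateHull_of_le`). Since `L r(L)` is largest at `LI`, a larger
active set is dominated by averages over its `LI`-subsets, so its rate point is already in the hull
(`ratePoint_mem`).

Converse: the slot is independent of the past, so the mean service of each slot lies in the hull,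
and so does its time average. The queue recursion bounds mean arrivals by this average plus `E
q(T)/T`, which is arbitrarily small at suitable times `T` under strong stability. Lowering
coordinates and closedness of the hull finish the argument (`CausalPolicy.mean_mem_rateHull`).

Achievability: a relative interior point `a` leaves room for `a + ε` in the hull. Drawing active
sets with the corresponding convex weights gives a service rate exceeding the arrival rate by `ε` in
every queue, and a quadratic Lyapunov function yields strong stability
(`stationaryPolicy_stronglyStable`). -/

theorem lintegral_pi_prod {ι : Type*} [Fintype ι] {X : ι → Type*} [∀ i, MeasurableSpace (X i)]
    (μ : ∀ i, Measure (X i)) [∀ i, IsProbabilityMeasure (μ i)] (f : ∀ i, X i → ℝ≥0∞)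
    (hf : ∀ i, Measurable (f i)) :
    ∫⁻ x, ∏ i, f i (x i) ∂(Measure.pi μ) = ∏ i, ∫⁻ x, f i x ∂(μ i) := by
  have h := iIndepFun_pi (μ := μ) (X := f) (fun i => (hf i).aemeasurable)
  rw [lintegral_prod_eq_prod_lintegral_of_indepFun Finset.univ (fun i (x : ∀ i, X i) => f i (x i)) h
    (fun i => (hf i).comp (measurable_pi_apply i))]
  refine Finset.prod_congr rfl fun i _ => ?_
  exact (measurePreserving_eval μ i).lintegral_comp (hf i)

/-- Variance `1/2` is that of the real or imaginary part of a standard complex Gaussian; its density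
is `exp(-x²)/√π`, so the product is again a Gaussian integral. -/
theorem lintegral_exp_neg_mul_sq_gaussianReal {s : ℝ} (hs : 0 ≤ s) :
    ∫⁻ x, ENNReal.ofReal (Real.exp (-s * x ^ 2)) ∂(gaussianReal 0 (1 / 2)) =
      ENNReal.ofReal (√(1 + s)⁻¹) := by
  rw [gaussianReal_of_var_ne_zero _ (by norm_num),
    lintegral_withDensity_eq_lintegral_mul _ (measurable_gaussianPDF _ _) (by fun_prop)]
  have h : ∀ x : ℝ, (gaussianPDF 0 (1 / 2) * fun x => ENNReal.ofReal (Real.exp (-s * x ^ 2))) x =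
      ENNReal.ofReal ((√Real.pi)⁻¹ * Real.exp (-(1 + s) * x ^ 2)) := by
    intro x
    rw [Pi.mul_apply, gaussianPDF_def, ← ENNReal.ofReal_mul (gaussianPDFReal_nonneg _ _ _),
      gaussianPDFReal, mul_assoc, ← Real.exp_add]
    congr 3
    · congr 1
      push_cast
      ring
    · push_cast
      ring_nf
  simp_rw [h]
  have h1 : (0 : ℝ) < 1 + s := by linarith
  rw [← ofReal_integral_eq_lintegral_ofReal ((integrable_exp_neg_mul_sq h1).const_mul _)
    (ae_of_all _ fun x => by positivity), integral_const_mul, integral_gaussian,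
    Real.sqrt_div Real.pi_pos.le, Real.sqrt_inv]
  congr 1
  have := Real.sqrt_pos.2 Real.pi_pos
  field_simp

/-! ### Channel norm and quantization error -/

namespace Params

instance : IsProbabilityMeasure complexGaussian := by
  unfold complexGaussian
  have h : Measurable (fun z : ℝ × ℝ => (⟨z.1, z.2⟩ : ℂ)) :=
    Complex.measurableEquivRealProd.symm.measurable
  exact Measure.isProbabilityMeasure_map h.aemeasurable

theorem lintegral_exp_neg_mul_sq_complexGaussian {s : ℝ} (hs : 0 ≤ s) :
    ∫⁻ z, ENNReal.ofReal (Real.exp (-s * ‖z‖ ^ 2)) ∂complexGaussian =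
      ENNReal.ofReal (1 + s)⁻¹ := by
  have h : Measurable (fun z : ℝ × ℝ => (⟨z.1, z.2⟩ : ℂ)) :=
    Complex.measurableEquivRealProd.symm.measurable
  unfold complexGaussian
  rw [lintegral_map (by fun_prop) h]
  have h2 : ∀ z : ℝ × ℝ, ENNReal.ofReal (Real.exp (-s * ‖(⟨z.1, z.2⟩ : ℂ)‖ ^ 2)) =
      ENNReal.ofReal (Real.exp (-s * z.1 ^ 2)) * ENNReal.ofReal (Real.exp (-s * z.2 ^ 2)) := by
    intro z
    rw [← ENNReal.ofReal_mul (Real.exp_pos _).le, ← Real.exp_add, ← Complex.normSq_eq_norm_sq,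
      Complex.normSq_mk]
    ring_nf
  simp_rw [h2]
  rw [lintegral_prod_mul (f := fun x : ℝ => ENNReal.ofReal (Real.exp (-s * x ^ 2)))
    (g := fun x : ℝ => ENNReal.ofReal (Real.exp (-s * x ^ 2))) (by fun_prop) (by fun_prop),
    lintegral_exp_neg_mul_sq_gaussianReal hs, ← ENNReal.ofReal_mul (by positivity),
    Real.mul_self_sqrt (by positivity)]

variable (p : Params)

theorem measurable_normSq_sum : Measurable
    (fun h : Fin p.Nr × Fin p.Nt → ℂ => ∑ i, ‖h i‖ ^ 2) := by fun_prop

instance : IsProbabilityMeasure p.normSqLaw :=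
  Measure.isProbabilityMeasure_map p.measurable_normSq_sum.aemeasurable

theorem one_le_Q : 1 ≤ p.Q := by
  have := p.antennas
  unfold Q
  omega

theorem Q_add_one : p.Q + 1 = p.Nr * p.Nt := by
  have := p.antennas
  unfold Q
  rw [mul_comm p.Nr]
  omega

theorem lintegral_exp_neg_mul_normSqLaw {s : ℝ} (hs : 0 ≤ s) :
    ∫⁻ x, ENNReal.ofReal (Real.exp (-s * x)) ∂p.normSqLaw =
      ENNReal.ofReal ((1 + s) ^ (p.Q + 1))⁻¹ := by
  unfold normSqLaw
  rw [lintegral_map (by fun_prop) p.measurable_normSq_sum]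
  have h : ∀ h : Fin p.Nr × Fin p.Nt → ℂ, ENNReal.ofReal (Real.exp (-s * ∑ i, ‖h i‖ ^ 2)) =
      ∏ i, ENNReal.ofReal (Real.exp (-s * ‖h i‖ ^ 2)) := by
    intro h
    rw [← ENNReal.ofReal_prod_of_nonneg (fun _ _ => (Real.exp_pos _).le), ← Real.exp_sum,
      Finset.mul_sum]
  simp_rw [h]
  rw [lintegral_pi_prod _ (fun _ (z : ℂ) => ENNReal.ofReal (Real.exp (-s * ‖z‖ ^ 2)))
    (fun _ => by fun_prop)]
  simp_rw [lintegral_exp_neg_mul_sq_complexGaussian hs]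
  rw [Finset.prod_const, Finset.card_univ, Fintype.card_prod, Fintype.card_fin, Fintype.card_fin,
    ← p.Q_add_one, ← ENNReal.ofReal_pow (by positivity), inv_pow]

theorem δ_pos : 0 < p.δ := Real.rpow_pos_of_pos two_pos _

theorem δ_pow_Q : p.δ ^ p.Q = 2 ^ p.B := by
  have := p.one_le_Q
  rw [δ, ← Real.rpow_natCast, ← Real.rpow_mul two_pos.le, div_mul_cancel₀ _ (by positivity),
    Real.rpow_natCast]

/-- The power `Q + 1` left by the channel norm matches the density `ε^(Q-1)`: up to a constant, the
integrand is the derivative of `(ε / (1 + sε))^Q`. -/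
theorem lintegral_inv_pow_quantErrLaw {s : ℝ} (hs : 0 ≤ s) :
    ∫⁻ ε, ENNReal.ofReal ((1 + s * ε) ^ (p.Q + 1))⁻¹ ∂p.quantErrLaw =
      ENNReal.ofReal ((1 + s / p.δ) ^ p.Q)⁻¹ := by
  have hδ := p.δ_pos
  have hQ := p.one_le_Q
  unfold quantErrLaw
  rw [lintegral_withDensity_eq_lintegral_mul _ (by fun_prop) (by fun_prop)]
  have h1 : ∀ ε ∈ Set.Icc 0 (p.δ)⁻¹,
      ((fun ε : ℝ => ENNReal.ofReal (2 ^ p.B * p.Q * ε ^ (p.Q - 1))) *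
        fun ε => ENNReal.ofReal ((1 + s * ε) ^ (p.Q + 1))⁻¹) ε =
      ENNReal.ofReal (2 ^ p.B * p.Q * ε ^ (p.Q - 1) * ((1 + s * ε) ^ (p.Q + 1))⁻¹) := by
    intro ε hε
    have := hε.1
    rw [Pi.mul_apply, ← ENNReal.ofReal_mul (by positivity)]
  rw [setLIntegral_congr_fun measurableSet_Icc h1]
  have hcont : ContinuousOn
      (fun ε : ℝ => 2 ^ p.B * p.Q * ε ^ (p.Q - 1) * ((1 + s * ε) ^ (p.Q + 1))⁻¹)
      (Set.Icc 0 (p.δ)⁻¹) := by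
    refine ContinuousOn.mul (by fun_prop) (ContinuousOn.inv₀ (by fun_prop) ?_)
    intro ε hε
    have := hε.1
    positivity
  have hle : (0 : ℝ) ≤ (p.δ)⁻¹ := by positivity
  rw [← ofReal_integral_eq_lintegral_ofReal (hcont.integrableOn_Icc)
    ((ae_restrict_iff' measurableSet_Icc).2 (ae_of_all _ fun ε hε => by
      have := hε.1
      simp only [Pi.zero_apply]
      positivity)), integral_Icc_eq_integral_Ioc, ← intervalIntegral.integral_of_le hle,
    intervalIntegral.integral_eq_sub_of_hasDerivAt
      (f := fun ε : ℝ => 2 ^ p.B * (ε / (1 + s * ε)) ^ p.Q)]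
  · congr 1
    rw [← p.δ_pow_Q, zero_div, zero_pow (by omega), mul_zero, sub_zero, ← mul_pow, ← inv_pow]
    congr 1
    field_simp
  · intro ε hε
    rw [Set.uIcc_of_le hle] at hε
    have h0 := hε.1
    have hne : 1 + s * ε ≠ 0 := by positivity
    have hd : HasDerivAt (fun ε : ℝ => 1 + s * ε) s ε := by
      simpa using ((hasDerivAt_id ε).const_mul s).const_add 1
    have := (((hasDerivAt_id ε).div hd hne).pow p.Q).const_mul (2 ^ p.B)
    refine HasDerivAt.congr_deriv this ?_
    obtain ⟨m, hm⟩ : ∃ m, p.Q = m + 1 := ⟨p.Q - 1, by omega⟩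
    simp only [hm, id, Nat.add_sub_cancel, div_pow, Pi.div_apply]
    push_cast
    field_simp
    ring
  · rw [intervalIntegrable_iff_integrableOn_Icc_of_le hle]
    exact hcont.integrableOn_Icc

instance : IsProbabilityMeasure p.quantErrLaw := by
  constructor
  -- The case `s = 0` computes the total mass.
  have := p.lintegral_inv_pow_quantErrLaw le_rfl
  simpa using this

theorem ae_nonneg_quantErrLaw : ∀ᵐ ε ∂p.quantErrLaw, 0 ≤ ε :=
  (withDensity_absolutelyContinuous _ _).ae_le
    ((ae_restrict_iff' measurableSet_Icc).2 (ae_of_all _ fun _ hε => hε.1))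

theorem ae_nonneg_normSqLaw : ∀ᵐ x ∂p.normSqLaw, 0 ≤ x := by
  unfold normSqLaw
  rw [ae_map_iff p.measurable_normSq_sum.aemeasurable measurableSet_Ici]
  exact ae_of_all _ fun h => Finset.sum_nonneg fun i _ => by positivity

end Params

/-! ### Beta moments and the hypergeometric series -/

theorem ascPochhammer_eval_mul_Gamma {b : ℝ} (hb : 0 < b) (n : ℕ) :
    (ascPochhammer ℝ n).eval b * Real.Gamma b = Real.Gamma (b + n) := by
  induction n with
  | zero => simp
  | succ n ih =>
    rw [ascPochhammer_succ_eval, mul_right_comm, ih]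
    push_cast
    rw [← add_assoc, Real.Gamma_add_one (by positivity), mul_comm]

theorem beta_add_nat_div_beta {a b : ℝ} (ha : 0 < a) (hb : 0 < b) (n : ℕ) :
    beta a (b + n) / beta a b =
      (ascPochhammer ℝ n).eval b * ((ascPochhammer ℝ n).eval (a + b))⁻¹ := by
  have h1 := Real.Gamma_pos_of_pos ha
  have h2 := Real.Gamma_pos_of_pos hb
  have h3 := Real.Gamma_pos_of_pos (add_pos ha hb)
  have h4 := ascPochhammer_pos n _ (add_pos ha hb)
  unfold beta
  rw [← add_assoc, ← ascPochhammer_eval_mul_Gamma hb, ← ascPochhammer_eval_mul_Gamma (add_pos ha hb)]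
  field_simp

/-- The factor `(1 - y)^n` turns the density with parameter `b` into a multiple of the one with `b +
n`. -/
theorem lintegral_one_sub_pow_betaMeasure {a b : ℝ} (ha : 0 < a) (hb : 0 < b) (n : ℕ) :
    ∫⁻ y, ENNReal.ofReal ((1 - y) ^ n) ∂(betaMeasure a b) =
      ENNReal.ofReal ((ascPochhammer ℝ n).eval b * ((ascPochhammer ℝ n).eval (a + b))⁻¹) := by
  have hbn : 0 < b + n := by positivity
  unfold betaMeasure
  have hm : ∀ b : ℝ, Measurable (betaPDF a b) := fun b =>
    (measurable_betaPDFReal a b).ennreal_ofReal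
  rw [lintegral_withDensity_eq_lintegral_mul _ (hm b) (by fun_prop), ← beta_add_nat_div_beta ha hb]
  have h : ∀ y : ℝ, (betaPDF a b * fun y => ENNReal.ofReal ((1 - y) ^ n)) y =
      ENNReal.ofReal (beta a (b + n) / beta a b) * betaPDF a (b + n) y := by
    intro y
    have hB1 := beta_pos ha hb
    have hB2 := beta_pos ha hbn
    rw [Pi.mul_apply, betaPDF_eq, betaPDF_eq]
    split_ifs with hy
    · have hy0 := hy.1
      have hy1 : 0 < 1 - y := by linarith [hy.2]
      rw [← ENNReal.ofReal_mul (by positivity), ← ENNReal.ofReal_mul (by positivity),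
        show b + n - 1 = b - 1 + n by ring, Real.rpow_add_natCast hy1.ne']
      congr 1
      field_simp
    · simp
  simp_rw [h]
  rw [lintegral_const_mul _ (hm _), lintegral_betaPDF_eq_one ha hbn, mul_one]

theorem ae_mem_Ioo_betaMeasure (a b : ℝ) : ∀ᵐ y ∂(betaMeasure a b), 0 < y ∧ y < 1 := by
  unfold betaMeasure
  refine (ae_withDensity_iff (f := betaPDF a b)
    (measurable_betaPDFReal a b).ennreal_ofReal).2 ?_
  refine ae_of_all _ fun y hy => ?_
  by_contra h
  exact hy (by rw [betaPDF_eq, if_neg h, ENNReal.ofReal_zero])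

theorem ascPochhammer_eval_natCast_div_factorial (q n : ℕ) :
    ((n.factorial : ℝ)⁻¹) * (ascPochhammer ℝ n).eval ((q + 1 : ℕ) : ℝ) = ((n + q).choose q : ℝ) := by
  rw [← ascPochhammer_eval_cast, ascPochhammer_nat_eq_ascFactorial,
    Nat.ascFactorial_eq_factorial_mul_choose]
  have : (n.factorial : ℝ) ≠ 0 := by positivity
  push_cast
  rw [inv_mul_cancel_left₀ this, ← Nat.choose_symm_add, add_comm]

/-- Euler's integral for the hypergeometric function, in the form of an expectation. -/
theorem lintegral_inv_pow_betaMeasure {a b x : ℝ} (ha : 0 < a) (hb : 0 < b) (hx : 0 < x) (q : ℕ) :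
    ∫⁻ y, ENNReal.ofReal ((1 + x * y) ^ (q + 1))⁻¹ ∂(betaMeasure a b) =
      ENNReal.ofReal (((1 + x) ^ (q + 1))⁻¹ *
        ordinaryHypergeometric b ((q + 1 : ℕ) : ℝ) (a + b) (x / (1 + x))) := by
  have := isProbabilityMeasureBeta ha hb
  set z := x / (1 + x) with hz
  have hz0 : 0 < z := by positivity
  have hz1 : z < 1 := by rw [hz, div_lt_one (by positivity)]; linarith
  set t : ℕ → ℝ := fun n => ((n + q).choose q : ℝ) * z ^ n *
    ((ascPochhammer ℝ n).eval b * ((ascPochhammer ℝ n).eval (a + b))⁻¹) with ht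
  have ht0 : ∀ n, 0 ≤ t n := fun n => by
    have h1 := ascPochhammer_pos n _ hb
    have h2 := ascPochhammer_pos n _ (add_pos ha hb)
    positivity
  have hF : ordinaryHypergeometric b ((q + 1 : ℕ) : ℝ) (a + b) z = ∑' n, t n := by
    rw [ordinaryHypergeometric_eq_tsum]
    refine tsum_congr fun n => ?_
    rw [ht]
    simp only [smul_eq_mul]
    rw [← ascPochhammer_eval_natCast_div_factorial]
    ring
  -- Since `1 + xy = (1 + x)(1 - z(1 - y))`, the negative binomial series applies with ratio `z(1 -
  -- y) < 1`. Its terms are nonnegative, so it may be integrated termwise.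
  have hseries : ∀ y : ℝ, 0 < y ∧ y < 1 → ENNReal.ofReal ((1 + x * y) ^ (q + 1))⁻¹ =
      ENNReal.ofReal ((1 + x) ^ (q + 1))⁻¹ * ∑' n : ℕ,
        ENNReal.ofReal (((n + q).choose q : ℝ) * z ^ n) * ENNReal.ofReal ((1 - y) ^ n) := by
    intro y hy
    have hy1 : 0 < 1 - y := by linarith [hy.2]
    have hlt : z * (1 - y) < 1 := by nlinarith [hy.1]
    have hs := hasSum_choose_mul_geometric_of_norm_lt_one q (r := z * (1 - y))
      (by rw [Real.norm_of_nonneg (by positivity)]; exact hlt)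
    have h2 : ∀ n : ℕ, ENNReal.ofReal (((n + q).choose q : ℝ) * z ^ n) *
        ENNReal.ofReal ((1 - y) ^ n) = ENNReal.ofReal (((n + q).choose q : ℝ) * (z * (1 - y)) ^ n) := by
      intro n
      rw [← ENNReal.ofReal_mul (by positivity), mul_pow, mul_assoc]
    simp_rw [h2]
    rw [← ENNReal.ofReal_tsum_of_nonneg (fun n => by positivity) hs.summable, hs.tsum_eq,
      ← ENNReal.ofReal_mul (by positivity)]
    congr 1
    rw [one_div, ← mul_inv, ← mul_pow]
    congr 2
    rw [hz]
    field_simp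
    ring
  have key : ∫⁻ y, ENNReal.ofReal ((1 + x * y) ^ (q + 1))⁻¹ ∂(betaMeasure a b) =
      ENNReal.ofReal ((1 + x) ^ (q + 1))⁻¹ * ∑' n, ENNReal.ofReal (t n) := by
    rw [lintegral_congr_ae ((ae_mem_Ioo_betaMeasure a b).mono fun y hy => hseries y hy),
      lintegral_const_mul _ (by fun_prop), lintegral_tsum (fun n => by fun_prop)]
    congr 1
    refine tsum_congr fun n => ?_
    rw [lintegral_const_mul _ (by fun_prop), lintegral_one_sub_pow_betaMeasure ha hb,
      ← ENNReal.ofReal_mul (by positivity)]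
  -- Summability of the hypergeometric series comes from the integral itself, whose integrand is at
  -- most `1`; without it the real `tsum` would carry the default value `0`.
  have hfin : ∑' n, ENNReal.ofReal (t n) ≠ ⊤ := by
    intro htop
    have hle : ∫⁻ y, ENNReal.ofReal ((1 + x * y) ^ (q + 1))⁻¹ ∂(betaMeasure a b) ≤
        ∫⁻ _, 1 ∂(betaMeasure a b) := by
      refine lintegral_mono_ae ((ae_mem_Ioo_betaMeasure a b).mono fun y hy => ?_)
      rw [ENNReal.ofReal_le_one]
      exact inv_le_one_of_one_le₀ (one_le_pow₀ (by nlinarith [hy.1]))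
    rw [key, htop, ENNReal.mul_top (by simp only [ne_eq, ENNReal.ofReal_eq_zero, not_le]; positivity)]
      at hle
    simp at hle
  have hsum : Summable t := by
    have := ENNReal.summable_toReal hfin
    simpa only [ENNReal.toReal_ofReal (ht0 _)] using this
  rw [key, hF, ENNReal.ofReal_mul (by positivity), ENNReal.ofReal_tsum_of_nonneg ht0 hsum]

/-! ### The success probability of a stream -/

theorem expMeasure_Ici {x : ℝ} (hx : 0 ≤ x) :
    expMeasure 1 (Set.Ici x) = ENNReal.ofReal (Real.exp (-x)) := by
  have := isProbabilityMeasure_expMeasure one_pos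
  have h1 : expMeasure 1 {x} = 0 := by
    unfold expMeasure gammaMeasure
    exact withDensity_absolutelyContinuous _ _ (by simp)
  have h2 : expMeasure 1 (Set.Iic x) = ENNReal.ofReal (1 - Real.exp (-x)) := by
    rw [← ofReal_cdf, cdf_expMeasure_eq one_pos, if_pos hx, one_mul]
  have hexp : Real.exp (-x) ≤ 1 := Real.exp_le_one_iff.2 (by linarith)
  rw [← Set.Ioi_insert, Set.insert_eq, measure_union (by simp) measurableSet_Ioi, h1, zero_add,
    ← Set.compl_Iic, prob_compl_eq_one_sub measurableSet_Iic, h2, ← ENNReal.ofReal_one,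
    ← ENNReal.ofReal_sub _ (by linarith)]
  congr 1
  ring

/-! ### Leakage law and the factor `F` of one interferer -/

namespace Params

variable (p : Params)

theorem betaA_pos : 0 < p.betaA := by
  have hQ : (1 : ℝ) ≤ p.Q := by exact_mod_cast p.one_le_Q
  have hd : (1 : ℝ) ≤ p.d := by exact_mod_cast p.d_pos
  unfold betaA
  rw [← sub_div]
  apply div_pos _ (by linarith)
  nlinarith

theorem betaB_pos (h : p.Q ≠ 1) : 0 < p.betaB := by
  have hQ : (1 : ℝ) < p.Q := by
    have := p.one_le_Q
    exact_mod_cast (by omega : 1 < p.Q)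
  exact mul_pos (by linarith) p.betaA_pos

instance : IsProbabilityMeasure p.leakLaw := by
  unfold leakLaw
  split_ifs with h
  · exact Measure.isProbabilityMeasure_map (by fun_prop)
  · have := isProbabilityMeasureBeta p.betaA_pos (p.betaB_pos h)
    exact Measure.isProbabilityMeasure_map (by fun_prop)

theorem ae_nonneg_leakLaw : ∀ᵐ z ∂p.leakLaw, 0 ≤ z := by
  have hd : (0 : ℝ) < p.d := by exact_mod_cast p.d_pos
  unfold leakLaw
  rw [ae_map_iff (by fun_prop) measurableSet_Ici]
  split_ifs with h
  · rw [ae_dirac_iff (measurableSet_le (by fun_prop) (by fun_prop))]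
    positivity
  · filter_upwards [ae_mem_Ioo_betaMeasure p.betaA p.betaB] with y hy
    have := hy.1
    positivity

theorem lintegral_inv_pow_leakLaw :
    ∫⁻ z, ENNReal.ofReal ((1 + p.τ / p.δ * z) ^ p.Q)⁻¹ ∂p.leakLaw = ENNReal.ofReal p.F := by
  have hd : (0 : ℝ) < p.d := by exact_mod_cast p.d_pos
  have hδ := p.δ_pos
  have hτ := p.τ_pos
  have hz : 1 / (p.δ / (p.d * p.τ) + 1) = p.d * p.τ / p.δ / (1 + p.d * p.τ / p.δ) := by
    field_simp
  have hpow : (p.d * p.τ / p.δ + 1) ^ (-(p.Q : ℤ)) = ((1 + p.d * p.τ / p.δ) ^ p.Q)⁻¹ := by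
    rw [zpow_neg, zpow_natCast, add_comm]
  unfold leakLaw F
  rw [lintegral_map (by fun_prop) (by fun_prop), hz, hpow]
  split_ifs with h
  · rw [lintegral_dirac' _ (by fun_prop)]
    have hb : p.betaB = 0 := by simp [betaB, h]
    have h2 : ordinaryHypergeometric p.betaB (p.Q : ℝ) (p.betaA + p.betaB)
        (p.d * p.τ / p.δ / (1 + p.d * p.τ / p.δ)) = 1 := by
      simp only [hb, ordinaryHypergeometric_eq_tsum]
      -- For `b̆ = 0` every term of the series after the constant one vanishes.
      rw [tsum_eq_single 0 (fun n hn => by rw [ascPochhammer_ne_zero_eval_zero ℝ hn]; simp)]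
      simp
    rw [h2, h]
    congr 1
    field_simp
  · have h1 : ∀ y : ℝ, ENNReal.ofReal ((1 + p.τ / p.δ * (p.d * y)) ^ p.Q)⁻¹ =
        ENNReal.ofReal ((1 + p.d * p.τ / p.δ * y) ^ p.Q)⁻¹ := fun y => by
      rw [show p.τ / p.δ * (p.d * y) = p.d * p.τ / p.δ * y by ring]
    simp_rw [h1]
    obtain ⟨q, hq⟩ : ∃ q, p.Q = q + 1 := ⟨p.Q - 1, by have := p.one_le_Q; omega⟩
    rw [hq]
    exact lintegral_inv_pow_betaMeasure p.betaA_pos (p.betaB_pos h) (by positivity) q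

/-- The law of the three factors of the residual interference from one active transmitter. -/
noncomputable abbrev interfererLaw : Measure (ℝ × ℝ × ℝ) :=
  p.normSqLaw.prod (p.quantErrLaw.prod p.leakLaw)

theorem ae_nonneg_interfererLaw : ∀ᵐ w ∂p.interfererLaw, 0 ≤ w.1 * w.2.1 * w.2.2 := by
  have h1 := Measure.quasiMeasurePreserving_fst (μ := p.normSqLaw)
    (ν := p.quantErrLaw.prod p.leakLaw) |>.ae p.ae_nonneg_normSqLaw
  have h2 := (Measure.quasiMeasurePreserving_fst (μ := p.quantErrLaw) (ν := p.leakLaw) |>.comp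
    (Measure.quasiMeasurePreserving_snd (μ := p.normSqLaw))).ae p.ae_nonneg_quantErrLaw
  have h3 := (Measure.quasiMeasurePreserving_snd (μ := p.quantErrLaw) (ν := p.leakLaw) |>.comp
    (Measure.quasiMeasurePreserving_snd (μ := p.normSqLaw))).ae p.ae_nonneg_leakLaw
  filter_upwards [h1, h2, h3] with w hw1 hw2 hw3
  exact mul_nonneg (mul_nonneg hw1 hw2) hw3

/-- The integrals are taken in the order norm, error, leakage; each result has the form required by
the next. The factor `α` is absent because it cancels against that of the desired signal. -/
theorem lintegral_exp_interfererLaw :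
    ∫⁻ w, ENNReal.ofReal (Real.exp (-p.τ * (w.1 * w.2.1 * w.2.2))) ∂p.interfererLaw =
      ENNReal.ofReal p.F := by
  have hτ := p.τ_pos
  have h2 := Measure.quasiMeasurePreserving_fst (μ := p.quantErrLaw) (ν := p.leakLaw) |>.ae
    p.ae_nonneg_quantErrLaw
  have h3 := Measure.quasiMeasurePreserving_snd (μ := p.quantErrLaw) (ν := p.leakLaw) |>.ae
    p.ae_nonneg_leakLaw
  unfold interfererLaw
  rw [lintegral_prod_symm' _ (by fun_prop)]
  have hin : ∀ᵐ v ∂(p.quantErrLaw.prod p.leakLaw),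
      ∫⁻ x, ENNReal.ofReal (Real.exp (-p.τ * (x * v.1 * v.2))) ∂p.normSqLaw =
        ENNReal.ofReal ((1 + p.τ * v.2 * v.1) ^ (p.Q + 1))⁻¹ := by
    filter_upwards [h2, h3] with v hv2 hv3
    rw [← p.lintegral_exp_neg_mul_normSqLaw (s := p.τ * v.2 * v.1)
      (mul_nonneg (mul_nonneg hτ.le hv3) hv2)]
    refine lintegral_congr fun x => ?_
    congr 2
    ring
  rw [lintegral_congr_ae hin, lintegral_prod_symm' _ (by fun_prop), ← p.lintegral_inv_pow_leakLaw]
  refine lintegral_congr_ae ?_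
  filter_upwards [p.ae_nonneg_leakLaw] with z hz
  rw [p.lintegral_inv_pow_quantErrLaw (mul_nonneg hτ.le hz)]
  congr 4
  ring

/-- Positivity and the bound by `1` are read off the expectation that `F` represents, not off the
hypergeometric series. -/
theorem F_pos : 0 < p.F := by
  rw [← ENNReal.ofReal_pos, ← p.lintegral_exp_interfererLaw, lintegral_pos_iff_support (by fun_prop)]
  have : (Function.support fun w : ℝ × ℝ × ℝ =>
      ENNReal.ofReal (Real.exp (-p.τ * (w.1 * w.2.1 * w.2.2)))) = Set.univ := by
    ext w
    simp [Real.exp_pos]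
  rw [this, measure_univ]
  exact one_pos

theorem F_le_one : p.F ≤ 1 := by
  have hτ := p.τ_pos
  rw [← ENNReal.ofReal_le_one, ← p.lintegral_exp_interfererLaw]
  calc _ ≤ ∫⁻ _, 1 ∂p.interfererLaw := by
        refine lintegral_mono_ae (p.ae_nonneg_interfererLaw.mono fun w hw => ?_)
        rw [ENNReal.ofReal_le_one, Real.exp_le_one_iff]
        nlinarith
    _ = 1 := by simp

theorem α_pos : 0 < p.α := by
  have hd : (0 : ℝ) < p.d := by exact_mod_cast p.d_pos
  exact div_pos (mul_pos p.P_pos p.ζ_pos) hd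

end Params

/-! ### SINR distribution and service bounds -/

namespace Fading

variable {p : Params} {H : Type*} [MeasurableSpace H] (c : Fading p H)

theorem measurable_sinr (S : Finset (Fin p.N)) (k : Fin p.N) (m : Fin p.d) :
    Measurable (c.sinr S k m) := by
  unfold sinr
  refine Measurable.div ((c.measurable_gain S k m).const_mul _) ?_
  refine Measurable.const_add (Finset.measurable_sum _ fun i _ => ?_) _
  exact (((c.measurable_normSq k i).const_mul _).mul (c.measurable_err k i)).mul
    (c.measurable_leak S k i m)

theorem law_sinr_ge {S : Finset (Fin p.N)} {k : Fin p.N} (hk : k ∈ S) (m : Fin p.d) :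
    c.law {h | p.τ ≤ c.sinr S k m h} =
      ENNReal.ofReal (Real.exp (-(p.sigma ^ 2 * p.τ / p.α)) * p.F ^ (S.card - 1)) := by
  have hα := p.α_pos
  have hτ := p.τ_pos
  have hσ := p.sigma_pos
  have := isProbabilityMeasure_expMeasure one_pos
  let T : Type := {i // i ∈ S.erase k}
  let f : ℝ × (T → ℝ × ℝ × ℝ) → ℝ := fun x =>
    p.α * x.1 / (p.sigma ^ 2 + ∑ i, p.α * (x.2 i).1 * (x.2 i).2.1 * (x.2 i).2.2)
  have hf : Measurable f := by fun_prop
  have hmeas : MeasurableSet {x | p.τ ≤ f x} := measurableSet_le measurable_const hf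
  have h1 := (c.hasLaw S k hk m).measure_eq hmeas
  have h2 : {h | p.τ ≤ c.sinr S k m h} = {h | p.τ ≤ f (c.gain S k m h,
      fun i : T => (c.normSq k i h, c.err k i h, c.leak S k i m h))} := by
    ext h
    simp only [Set.mem_ofPred_eq, f, sinr]
    rw [← Finset.sum_coe_sort (S.erase k)
      (fun i => p.α * c.normSq k i h * c.err k i h * c.leak S k i m h)]
  rw [h2, h1, Measure.prod_apply_symm hmeas]
  have hae : ∀ᵐ w ∂(Measure.pi fun _ : T => p.interfererLaw),
      ∀ i, 0 ≤ (w i).1 * (w i).2.1 * (w i).2.2 := by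
    rw [ae_all_iff]
    intro i
    exact (measurePreserving_eval (fun _ : T => p.interfererLaw) i).quasiMeasurePreserving.ae
      p.ae_nonneg_interfererLaw
  have hint : ∀ᵐ w ∂(Measure.pi fun _ : T => p.interfererLaw),
      expMeasure 1 ((fun x => (x, w)) ⁻¹' {x | p.τ ≤ f x}) =
        ENNReal.ofReal (Real.exp (-(p.sigma ^ 2 * p.τ / p.α))) *
          ∏ i, ENNReal.ofReal (Real.exp (-p.τ * ((w i).1 * (w i).2.1 * (w i).2.2))) := by
    filter_upwards [hae] with w hw
    have hs : 0 ≤ ∑ i, (w i).1 * (w i).2.1 * (w i).2.2 := Finset.sum_nonneg fun i _ => hw i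
    -- With nonnegative interference the denominator is positive, so the SINR condition becomes a
    -- lower threshold on the gain.
    have hset : (fun x => (x, w)) ⁻¹' {x | p.τ ≤ f x} =
        Set.Ici (p.sigma ^ 2 * p.τ / p.α + p.τ * ∑ i, (w i).1 * (w i).2.1 * (w i).2.2) := by
      ext x
      simp only [Set.mem_preimage, Set.mem_ofPred_eq, f, Set.mem_Ici]
      have h3 : ∑ i, p.α * (w i).1 * (w i).2.1 * (w i).2.2 =
          p.α * ∑ i, (w i).1 * (w i).2.1 * (w i).2.2 := by
        rw [Finset.mul_sum]
        exact Finset.sum_congr rfl fun i _ => by ring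
      rw [h3, le_div_iff₀ (by positivity), div_add' _ _ _ hα.ne', div_le_iff₀ hα]
      constructor <;> intro h <;> linarith
    rw [hset, expMeasure_Ici (by positivity), ← ENNReal.ofReal_prod_of_nonneg
      (fun _ _ => (Real.exp_pos _).le), ← Real.exp_sum, ← ENNReal.ofReal_mul (Real.exp_pos _).le,
      ← Real.exp_add, ← Finset.mul_sum]
    congr 2
    ring
  rw [lintegral_congr_ae hint, lintegral_const_mul _ (by fun_prop),
    lintegral_pi_prod (fun _ : T => p.interfererLaw)
      (fun _ w => ENNReal.ofReal (Real.exp (-p.τ * (w.1 * w.2.1 * w.2.2)))) (fun _ => by fun_prop)]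
  simp_rw [p.lintegral_exp_interfererLaw]
  rw [Finset.prod_const, Finset.card_univ, Fintype.card_coe, Finset.card_erase_of_mem hk,
    ← ENNReal.ofReal_pow p.F_pos.le, ← ENNReal.ofReal_mul (Real.exp_pos _).le]

theorem one_sub_card_mul_pos (S : Finset (Fin p.N)) : 0 < 1 - (S.card : ℝ) * p.θ := by
  have h1 : (S.card : ℝ) ≤ p.N := by
    exact_mod_cast (Finset.card_le_univ S).trans_eq (Fintype.card_fin _)
  nlinarith [p.Nθ_lt_one, p.θ_pos]

theorem measurable_service (S : Finset (Fin p.N)) (k : Fin p.N) :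
    Measurable fun h => c.service S h k := by
  unfold service
  split_ifs
  · refine Measurable.const_mul (Finset.measurable_sum _ fun m _ => ?_) _
    exact Measurable.ite (measurableSet_le measurable_const (c.measurable_sinr S k m))
      measurable_const measurable_const
  · exact measurable_const

theorem service_nonneg (S : Finset (Fin p.N)) (h : H) (k : Fin p.N) : 0 ≤ c.service S h k := by
  unfold service
  split_ifs
  · refine mul_nonneg (one_sub_card_mul_pos S).le (Finset.sum_nonneg fun m _ => ?_)
    split_ifs
    exacts [p.R_pos.le, le_rfl]
  · exact le_rfl

theorem service_le (S : Finset (Fin p.N)) (h : H) (k : Fin p.N) :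
    c.service S h k ≤ p.d * p.R := by
  have hR := p.R_pos
  unfold service
  split_ifs
  · have h1 : ∑ m : Fin p.d, (if p.τ ≤ c.sinr S k m h then p.R else 0) ≤ p.d * p.R := by
      calc _ ≤ ∑ _m : Fin p.d, p.R := Finset.sum_le_sum fun m _ => by split_ifs <;> linarith
        _ = p.d * p.R := by simp
    have h2 : 0 ≤ ∑ m : Fin p.d, (if p.τ ≤ c.sinr S k m h then p.R else 0) :=
      Finset.sum_nonneg fun m _ => by split_ifs <;> linarith
    have h3 : 0 ≤ (S.card : ℝ) * p.θ := mul_nonneg (Nat.cast_nonneg _) p.θ_pos.le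
    nlinarith
  · positivity

end Fading

namespace Params

variable (p : Params)

/-- The vector of average service rates when the pairs in `S` are active. -/
noncomputable def ratePoint (S : Finset (Fin p.N)) : Fin p.N → ℝ :=
  fun k => if k ∈ S then p.r S.card else 0

theorem r_succ (L : ℕ) : p.r (L + 1) =
    (1 - (L + 1 : ℕ) * p.θ) * p.d * p.R * Real.exp (-(p.sigma ^ 2 * p.τ / p.α)) * p.F ^ L := by
  unfold r
  congr 1
  push_cast
  rw [add_sub_cancel_right, zpow_natCast]

end Params

theorem Fading.lintegral_service {p : Params} {H : Type*} [MeasurableSpace H] (c : Fading p H)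
    (S : Finset (Fin p.N)) (k : Fin p.N) :
    ∫⁻ h, ENNReal.ofReal (c.service S h k) ∂c.law = ENNReal.ofReal (p.ratePoint S k) := by
  have hR := p.R_pos
  unfold Fading.service Params.ratePoint
  split_ifs with hk
  · have hθ := Fading.one_sub_card_mul_pos S
    have h1 : ∀ h, ENNReal.ofReal ((1 - (S.card : ℝ) * p.θ) *
        ∑ m : Fin p.d, (if p.τ ≤ c.sinr S k m h then p.R else 0)) =
        ENNReal.ofReal (1 - S.card * p.θ) * ∑ m : Fin p.d,
          ENNReal.ofReal p.R * {h | p.τ ≤ c.sinr S k m h}.indicator 1 h := by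
      intro h
      rw [ENNReal.ofReal_mul hθ.le, ENNReal.ofReal_sum_of_nonneg
        (fun m _ => by split_ifs <;> linarith)]
      congr 1
      refine Finset.sum_congr rfl fun m _ => ?_
      by_cases hm : p.τ ≤ c.sinr S k m h <;> simp [hm]
    have hms : ∀ m, MeasurableSet {h | p.τ ≤ c.sinr S k m h} := fun m =>
      measurableSet_le measurable_const (c.measurable_sinr S k m)
    have hmi : ∀ m, Measurable ({h | p.τ ≤ c.sinr S k m h}.indicator (1 : H → ℝ≥0∞)) := fun m =>
      measurable_one.indicator (hms m)
    simp_rw [h1]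
    rw [lintegral_const_mul _ (Finset.measurable_sum _ fun m _ => (hmi m).const_mul _),
      lintegral_finsetSum _ (fun m _ => (hmi m).const_mul _)]
    simp_rw [fun m => lintegral_const_mul (μ := c.law) (ENNReal.ofReal p.R) (hmi m),
      fun m => lintegral_indicator_one (μ := c.law) (hms m), c.law_sinr_ge hk]
    -- An active user makes `S` nonempty, which reconciles the natural exponent `S.card - 1` with
    -- the integer exponent in `r`.
    obtain ⟨L, hL⟩ : ∃ L, S.card = L + 1 :=
      ⟨S.card - 1, by have := Finset.card_pos.2 ⟨k, hk⟩; omega⟩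
    rw [Finset.sum_const, Finset.card_univ, Fintype.card_fin, nsmul_eq_mul,
      ← ENNReal.ofReal_natCast, ← ENNReal.ofReal_mul hR.le, ← ENNReal.ofReal_mul (by positivity),
      ← ENNReal.ofReal_mul hθ.le, hL, p.r_succ, Nat.add_sub_cancel]
    congr 1
    ring
  · simp

/-! ### Geometry of the rate region -/

namespace Params

variable (p : Params)

theorem r_pos {L : ℕ} (h1 : 1 ≤ L) (hL : L ≤ p.N) : 0 < p.r L := by
  obtain ⟨M, rfl⟩ : ∃ M, L = M + 1 := ⟨L - 1, by omega⟩
  have hd : (0 : ℝ) < p.d := by exact_mod_cast p.d_pos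
  have hL' : ((M + 1 : ℕ) : ℝ) ≤ p.N := by exact_mod_cast hL
  have h : 0 < 1 - ((M + 1 : ℕ) : ℝ) * p.θ := by nlinarith [p.Nθ_lt_one, p.θ_pos]
  have hR := p.R_pos
  have hF := p.F_pos
  rw [r_succ]
  positivity

theorem r_succ_le {L : ℕ} (h1 : 1 ≤ L) (hL : L + 1 ≤ p.N) : p.r (L + 1) ≤ p.r L := by
  obtain ⟨M, rfl⟩ : ∃ M, L = M + 1 := ⟨L - 1, by omega⟩
  have hd : (0 : ℝ) < p.d := by exact_mod_cast p.d_pos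
  have hL' : ((M + 1 + 1 : ℕ) : ℝ) ≤ p.N := by exact_mod_cast hL
  have h : 0 < 1 - ((M + 1 + 1 : ℕ) : ℝ) * p.θ := by nlinarith [p.Nθ_lt_one, p.θ_pos]
  have hR := p.R_pos
  have hθ := p.θ_pos
  have hF := p.F_pos
  have h2 : 1 - ((M + 1 + 1 : ℕ) : ℝ) * p.θ ≤ 1 - ((M + 1 : ℕ) : ℝ) * p.θ := by
    push_cast
    linarith
  rw [r_succ, r_succ]
  generalize 1 - ((M + 1 + 1 : ℕ) : ℝ) * p.θ = u at h h2
  generalize 1 - ((M + 1 : ℕ) : ℝ) * p.θ = v at h2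
  have hv : 0 < v := h.trans_le h2
  refine mul_le_mul ?_ (pow_le_pow_of_le_one hF.le p.F_le_one (by omega)) (by positivity)
    (by positivity)
  gcongr

theorem one_le_of_isMax {LI : ℕ} (hLI : ∀ L : ℕ, p.rT L ≤ p.rT LI) : 1 ≤ LI := by
  by_contra h
  have h0 : LI = 0 := by omega
  have h1 := hLI 1
  have h2 := p.r_pos le_rfl p.N_pos
  simp [h0, rT] at h1
  linarith

theorem card_le_N (S : Finset (Fin p.N)) : S.card ≤ p.N :=
  (Finset.card_le_univ S).trans_eq (Fintype.card_fin _)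

theorem ratePoint_nonneg (S : Finset (Fin p.N)) (k : Fin p.N) : 0 ≤ p.ratePoint S k := by
  unfold ratePoint
  split_ifs with h
  · exact (p.r_pos (Finset.card_pos.2 ⟨k, h⟩) (p.card_le_N S)).le
  · exact le_rfl

theorem iUnion_ratePoints (M : ℕ) :
    (⋃ L ∈ Finset.range (M + 1), p.ratePoints L) = p.ratePoint '' {S | S.card ≤ M} := by
  ext x
  simp only [Set.mem_iUnion, Finset.mem_range, ratePoints, Set.mem_ofPred_eq, Set.mem_image,
    exists_prop]
  constructor
  · rintro ⟨L, hL, S, rfl, rfl⟩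
    exact ⟨S, by omega, rfl⟩
  · rintro ⟨S, hS, rfl⟩
    exact ⟨S.card, by omega, S, rfl, rfl⟩

theorem rateHull_eq (M : ℕ) : p.rateHull M = convexHull ℝ (p.ratePoint '' {S | S.card ≤ M}) := by
  rw [rateHull, iUnion_ratePoints]

theorem convex_rateHull (M : ℕ) : Convex ℝ (p.rateHull M) := convex_convexHull _ _

theorem isClosed_rateHull (M : ℕ) : IsClosed (p.rateHull M) := by
  rw [rateHull_eq]
  exact ((Set.toFinite _).isCompact_convexHull ℝ).isClosed

theorem ratePoint_mem_rateHull {M : ℕ} {S : Finset (Fin p.N)} (hS : S.card ≤ M) :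
    p.ratePoint S ∈ p.rateHull M := by
  rw [rateHull_eq]
  exact subset_convexHull _ _ ⟨S, hS, rfl⟩

theorem ratePoint_empty : p.ratePoint ∅ = 0 := by
  ext k
  simp [ratePoint]

theorem zero_mem_rateHull (M : ℕ) : 0 ∈ p.rateHull M := by
  rw [← p.ratePoint_empty]
  exact p.ratePoint_mem_rateHull (by simp)

/-- The vector equal to `x` on `S` and to `0` elsewhere. -/
noncomputable def constOn (x : ℝ) (S : Finset (Fin p.N)) : Fin p.N → ℝ :=
  fun k => if k ∈ S then x else 0

theorem constOn_mem_of_le {M : ℕ} {x y : ℝ} {S : Finset (Fin p.N)} (hy : 0 ≤ y) (hyx : y ≤ x)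
    (h : p.constOn x S ∈ p.rateHull M) : p.constOn y S ∈ p.rateHull M := by
  rcases hy.eq_or_lt with rfl | hy
  · convert p.zero_mem_rateHull M using 1
    ext k
    simp [constOn]
  · have := (p.convex_rateHull M).smul_mem_of_zero_mem (p.zero_mem_rateHull M) h (t := y / x)
      ⟨div_nonneg hy.le (hy.le.trans hyx), div_le_one_of_le₀ hyx (hy.le.trans hyx)⟩
    convert this using 1
    ext k
    have : x ≠ 0 := by linarith
    simp [constOn, this]

theorem rateHull_nonneg {M : ℕ} {x : Fin p.N → ℝ} (hx : x ∈ p.rateHull M) : 0 ≤ x := by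
  rw [rateHull_eq] at hx
  refine convexHull_min ?_ (convex_Ici (0 : Fin p.N → ℝ)) hx
  rintro _ ⟨S, -, rfl⟩
  exact p.ratePoint_nonneg S

/-- Erasing a coordinate is linear, so vertices suffice. Without user `k`, the remaining users of
`S` could be served at `r(|S| - 1) ≥ r(|S|)`, and their vector is a scaled-down copy of that vertex.
-/
theorem update_zero_mem_rateHull {M : ℕ} {x : Fin p.N → ℝ} (hx : x ∈ p.rateHull M) (k : Fin p.N) :
    Function.update x k 0 ∈ p.rateHull M := by
  let f : (Fin p.N → ℝ) →ₗ[ℝ] (Fin p.N → ℝ) :=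
    { toFun := fun x => Function.update x k 0
      map_add' := fun x y => by rw [← Function.update_add, add_zero]
      map_smul' := fun c x => by rw [← Function.update_smul]; simp }
  have hsub : p.rateHull M ⊆ f ⁻¹' p.rateHull M := by
    conv_lhs => rw [rateHull_eq]
    refine convexHull_min ?_ ((p.convex_rateHull M).linear_preimage f)
    rintro _ ⟨S, hS, rfl⟩
    change Function.update (p.ratePoint S) k 0 ∈ p.rateHull M
    by_cases hk : k ∈ S
    · have h1 : Function.update (p.ratePoint S) k 0 = p.constOn (p.r S.card) (S.erase k) := by
        ext j
        by_cases hj : j = k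
        · subst hj; simp [constOn]
        · simp [constOn, ratePoint, hj]
      rw [h1]
      have hc := Finset.card_erase_add_one hk
      have hS' : S.card ≤ M := hS
      rcases Nat.eq_zero_or_pos (S.erase k).card with h0 | h0
      · rw [Finset.card_eq_zero.1 h0]
        convert p.zero_mem_rateHull M using 1
        ext j
        simp [constOn]
      · refine p.constOn_mem_of_le (x := p.r (S.erase k).card)
          (p.r_pos (by omega) (p.card_le_N S)).le ?_
          (p.ratePoint_mem_rateHull (by omega))
        rw [← hc]
        exact p.r_succ_le h0 (by rw [hc]; exact p.card_le_N S)
    · have h1 : Function.update (p.ratePoint S) k 0 = p.ratePoint S := by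
        rw [Function.update_eq_self_iff]
        simp [ratePoint, hk]
      rw [h1]
      exact p.ratePoint_mem_rateHull hS
  exact hsub hx

theorem update_mem_rateHull {M : ℕ} {x : Fin p.N → ℝ} (hx : x ∈ p.rateHull M) (k : Fin p.N) {y : ℝ}
    (hy : 0 ≤ y) (hyx : y ≤ x k) : Function.update x k y ∈ p.rateHull M := by
  rcases hy.eq_or_lt with rfl | hy
  · exact p.update_zero_mem_rateHull hx k
  · have hxk : 0 < x k := hy.trans_le hyx
    have := (p.convex_rateHull M) (p.update_zero_mem_rateHull hx k) hx (a := 1 - y / x k)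
      (b := y / x k) (sub_nonneg.2 (div_le_one_of_le₀ hyx hxk.le)) (by positivity) (by ring)
    convert this using 1
    ext j
    by_cases hj : j = k
    · subst hj
      simp [hxk.ne']
    · simp [hj]
      ring

/-- The rate region is closed under decreasing the rates. -/
theorem mem_rateHull_of_le {M : ℕ} {x y : Fin p.N → ℝ} (hx : x ∈ p.rateHull M) (hy : 0 ≤ y)
    (hyx : y ≤ x) : y ∈ p.rateHull M := by
  -- Coordinates are lowered one at a time; `T` collects those already lowered.
  suffices h : ∀ T : Finset (Fin p.N), T.piecewise y x ∈ p.rateHull M by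
    simpa using h Finset.univ
  intro T
  induction T using Finset.induction_on with
  | empty => simpa using hx
  | insert k T hk ih =>
    rw [Finset.piecewise_insert]
    exact p.update_mem_rateHull ih k (hy k) (by simpa [hk] using hyx k)

/-- The total `LI r(LI)` can be spread evenly over any larger set: the even vector on `S` is the
average over `k ∈ S` of the even vectors on `S.erase k`, because each user survives `|S| - 1` of the
`|S|` erasures. -/
theorem constOn_mem_rateHull {LI : ℕ} (h1 : 1 ≤ LI) (S : Finset (Fin p.N)) (n : ℕ)
    (hn : S.card = LI + n) : p.constOn (p.rT LI / S.card) S ∈ p.rateHull LI := by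
  induction n generalizing S with
  | zero =>
    have : (LI : ℝ) ≠ 0 := by positivity
    rw [add_zero] at hn
    have h2 : p.rT LI / S.card = p.r S.card := by
      rw [hn, rT]
      field_simp
    rw [h2]
    exact p.ratePoint_mem_rateHull hn.le
  | succ n ih =>
    have hpos : (0 : ℝ) < S.card := by rw [hn]; positivity
    have hmem := (p.convex_rateHull LI).sum_mem (t := S) (w := fun _ => (S.card : ℝ)⁻¹)
      (z := fun k => p.constOn (p.rT LI / (S.erase k).card) (S.erase k))
      (fun _ _ => by positivity) (by simp [hpos.ne'])
      (fun k hk => ih (S.erase k) (by rw [Finset.card_erase_of_mem hk]; omega))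
    convert hmem using 1
    ext j
    have hc : ∀ k ∈ S, ((S.erase k).card : ℝ) = S.card - 1 := fun k hk => by
      rw [← Finset.card_erase_add_one hk]
      push_cast
      ring
    have hc1 : (S.card : ℝ) - 1 ≠ 0 := by
      rw [hn]
      have : (1 : ℝ) ≤ LI := by exact_mod_cast h1
      push_cast
      intro h
      have : (0 : ℝ) ≤ n := n.cast_nonneg
      linarith
    rw [Finset.sum_apply]
    have hterm : ∀ k ∈ S, ((S.card : ℝ)⁻¹ • p.constOn (p.rT LI / (S.erase k).card) (S.erase k)) j =
        if j ∈ S.erase k then (S.card : ℝ)⁻¹ * (p.rT LI / (S.card - 1)) else 0 := fun k hk => by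
      rw [Pi.smul_apply, smul_eq_mul, constOn, hc k hk, mul_ite, mul_zero]
    rw [Finset.sum_congr rfl hterm]
    by_cases hj : j ∈ S
    · have hfil : S.filter (fun k => j ∈ S.erase k) = S.erase j := by
        ext k
        simp only [Finset.mem_filter, Finset.mem_erase]
        tauto
      rw [← Finset.sum_filter, hfil, Finset.sum_const, nsmul_eq_mul, hc j hj, constOn, if_pos hj]
      field_simp
    · simp [constOn, hj]

/-- Activating more than `LI` pairs does not leave the rate region. -/
theorem ratePoint_mem {LI : ℕ} (hLI : ∀ L : ℕ, p.rT L ≤ p.rT LI) (S : Finset (Fin p.N)) :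
    p.ratePoint S ∈ p.rateHull LI := by
  rcases le_total S.card LI with h | h
  · exact p.ratePoint_mem_rateHull h
  · have h1 := p.one_le_of_isMax hLI
    refine p.constOn_mem_of_le (p.r_pos (by omega) (p.card_le_N S)).le ?_
      (p.constOn_mem_rateHull h1 S (S.card - LI) (by omega))
    -- After clearing the denominator this is the maximality of `LI r(LI)`.
    rw [le_div_iff₀ (by exact_mod_cast (by omega : 0 < S.card)), mul_comm]
    exact hLI S.card

/-- The rate region contains a box around the origin of the orthant. -/
theorem exists_const_mem_rateHull {LI : ℕ} (hLI : ∀ L : ℕ, p.rT L ≤ p.rT LI) :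
    ∃ η > 0, (fun _ => η) ∈ p.rateHull LI := by
  refine ⟨p.r p.N, p.r_pos p.N_pos le_rfl, ?_⟩
  have := p.ratePoint_mem hLI Finset.univ
  unfold ratePoint at this
  simpa using this

theorem exists_weights_of_mem_rateHull {LI : ℕ} {x : Fin p.N → ℝ} (hx : x ∈ p.rateHull LI) :
    ∃ w : Finset (Fin p.N) → ℝ, (∀ S, 0 ≤ w S) ∧ ∑ S, w S = 1 ∧ ∑ S, w S • p.ratePoint S = x := by
  have h : p.rateHull LI ⊆ convexHull ℝ (Set.range p.ratePoint) := by
    rw [rateHull_eq]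
    exact convexHull_mono (Set.image_subset_range _ _)
  obtain ⟨s, w, hw0, hw1, hx⟩ := by
    have := h hx
    rw [convexHull_range_eq_exists_affineCombination] at this
    exact this
  refine ⟨fun S => if S ∈ s then w S else 0, fun S => ?_, ?_, ?_⟩
  · dsimp only
    split_ifs with hS
    exacts [hw0 S hS, le_rfl]
  · simpa using hw1
  · rw [← hx, Finset.affineCombination_eq_linear_combination _ _ _ hw1]
    simp

end Params

/-! ### Past and present of an i.i.d. sequence -/

/-- The coordinates before `t` and the coordinate `t` are disjoint blocks of an independent family,
so their joint law is a product. This replaces conditioning on the past. -/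
theorem lintegral_infinitePi_past_present {X : Type*} [MeasurableSpace X] (μ : Measure X)
    [IsProbabilityMeasure μ] (t : ℕ) {f : (Fin t → X) × X → ℝ≥0∞} (hf : Measurable f) :
    ∫⁻ ω, f (fun i => ω i, ω t) ∂(Measure.infinitePi fun _ : ℕ => μ) =
      ∫⁻ x, ∫⁻ y, f (x, y) ∂μ ∂((Measure.infinitePi fun _ : ℕ => μ).map
        fun ω (i : Fin t) => ω i) := by
  have hind : iIndepFun (fun (i : ℕ) (ω : ℕ → X) => ω i) (Measure.infinitePi fun _ : ℕ => μ) :=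
    iIndepFun_infinitePi (P := fun _ : ℕ => μ) (X := fun _ x => x) (fun _ => measurable_id)
  have h1 := hind.indepFun_finset (Finset.range t) {t} (by simp)
    (fun i => measurable_pi_apply i)
  have hφ : Measurable fun (x : (Finset.range t) → X) (i : Fin t) =>
      x ⟨i, Finset.mem_range.2 i.2⟩ := by fun_prop
  have hψ : Measurable fun x : (({t} : Finset ℕ) → X) => x ⟨t, Finset.mem_singleton_self t⟩ := by
    fun_prop
  have h2 := h1.comp hφ hψ
  have hm1 : Measurable fun (ω : ℕ → X) (i : Fin t) => ω i := by fun_prop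
  have hm2 : Measurable fun ω : ℕ → X => ω t := by fun_prop
  have h3 := (indepFun_iff_map_prod_eq_prod_map_map hm1.aemeasurable hm2.aemeasurable).1 h2
  have h4 : (Measure.infinitePi fun _ : ℕ => μ).map (fun ω => ω t) = μ :=
    (measurePreserving_eval_infinitePi (fun _ : ℕ => μ) t).map_eq
  have := Measure.isProbabilityMeasure_map (μ := Measure.infinitePi fun _ : ℕ => μ)
    hm1.aemeasurable
  rw [h4] at h3
  rw [← lintegral_prod _ hf.aemeasurable, ← h3, lintegral_map hf (hm1.prodMk hm2)]

/-! ### Queues as functions of the past, and mean service in a slot -/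

section Dynamics

variable {p : Params} {H : Type*} [MeasurableSpace H] (c : Fading p H)

theorem measurable_service_comp {α : Type*} [MeasurableSpace α] {S : α → Finset (Fin p.N)}
    {h : α → H} (hS : ∀ T, MeasurableSet {a | S a = T}) (hh : Measurable h) (k : Fin p.N) :
    Measurable fun a => c.service (S a) (h a) k := by
  have h1 : (fun a => c.service (S a) (h a) k) =
      fun a => ∑ T, if S a = T then c.service T (h a) k else 0 := by
    ext a
    simp
  rw [h1]
  exact Finset.measurable_sum _ fun T _ =>
    Measurable.ite (hS T) ((c.measurable_service T k).comp hh) measurable_const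

theorem measurable_step {α : Type*} [MeasurableSpace α] {q : α → Fin p.N → ℝ}
    {S : α → Finset (Fin p.N)} {x : α → Slot p H} (hq : Measurable q)
    (hS : ∀ T, MeasurableSet {a | S a = T}) (hx : Measurable x) :
    Measurable fun a => step c (q a) (S a) (x a) := by
  refine measurable_pi_lambda _ fun k => ?_
  refine Measurable.add (Measurable.max (Measurable.sub ?_ ?_) measurable_const) ?_
  · exact (measurable_pi_apply k).comp hq
  · exact measurable_service_comp c hS (measurable_fst.comp (measurable_snd.comp hx)) k
  · exact (measurable_pi_apply k).comp (measurable_fst.comp hx)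

/-- The queue lengths at time `t` as a function of the slots before `t`. -/
noncomputable def CausalPolicy.pastQueue (π : CausalPolicy p H) (q0 : Fin p.N → ℝ) :
    (t : ℕ) → (Fin t → Slot p H) → Fin p.N → ℝ
  | 0, _ => q0
  | t + 1, x => step c (CausalPolicy.pastQueue π q0 t (fun i => x i.castSucc))
      (π.choose t (fun i => x i.castSucc) (x (Fin.last t)).2.2) (x (Fin.last t))

/-- The queue lengths at time `t` as a function of the slots before `t`. -/
noncomputable def Policy.pastQueue (π : Policy p) (q0 : Fin p.N → ℝ) :
    (t : ℕ) → (Fin t → Slot p H) → Fin p.N → ℝ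
  | 0, _ => q0
  | t + 1, x => step c (Policy.pastQueue π q0 t (fun i => x i.castSucc))
      (π.choose (Policy.pastQueue π q0 t (fun i => x i.castSucc)) (x (Fin.last t)).2.2)
      (x (Fin.last t))

theorem CausalPolicy.queue_eq_pastQueue (π : CausalPolicy p H) (q0 : Fin p.N → ℝ) (t : ℕ)
    (ω : ℕ → Slot p H) : π.queue c q0 t ω = π.pastQueue c q0 t (fun i => ω i) := by
  induction t with
  | zero => rfl
  | succ t ih =>
    simp only [CausalPolicy.queue, CausalPolicy.pastQueue, ih, Fin.val_castSucc, Fin.val_last]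

theorem CausalPolicy.measurable_pastQueue (π : CausalPolicy p H) (q0 : Fin p.N → ℝ) (t : ℕ) :
    Measurable (π.pastQueue c q0 t) := by
  induction t with
  | zero => exact measurable_const
  | succ t ih =>
    have hx : Measurable fun (x : Fin (t + 1) → Slot p H) (i : Fin t) => x i.castSucc := by fun_prop
    have hl : Measurable fun x : Fin (t + 1) → Slot p H => x (Fin.last t) := by fun_prop
    refine measurable_step c (ih.comp hx) (fun T => ?_) hl
    exact (hx.prodMk (measurable_snd.comp (measurable_snd.comp hl))) (π.measurable t T)

theorem Policy.measurable_pastQueue (π : Policy p) (q0 : Fin p.N → ℝ) (t : ℕ) :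
    Measurable (π.pastQueue c q0 t) := by
  induction t with
  | zero => exact measurable_const
  | succ t ih =>
    have hx : Measurable fun (x : Fin (t + 1) → Slot p H) (i : Fin t) => x i.castSucc := by fun_prop
    have hl : Measurable fun x : Fin (t + 1) → Slot p H => x (Fin.last t) := by fun_prop
    refine measurable_step c (ih.comp hx) (fun T => ?_) hl
    exact ((ih.comp hx).prodMk (measurable_snd.comp (measurable_snd.comp hl))) (π.measurable T)

/-- A centralized policy, seen as a causal policy. -/
noncomputable def Policy.toCausal (π : Policy p) (q0 : Fin p.N → ℝ) : CausalPolicy p H where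
  choose t x u := π.choose (π.pastQueue c q0 t x) u
  measurable t S :=
    ((π.measurable_pastQueue c q0 t).comp measurable_fst |>.prodMk measurable_snd)
      (π.measurable S)

theorem Policy.queue_eq_pastQueue (π : Policy p) (q0 : Fin p.N → ℝ) (t : ℕ)
    (ω : ℕ → Slot p H) : π.queue c q0 t ω = π.pastQueue c q0 t (fun i => ω i) := by
  induction t with
  | zero => rfl
  | succ t ih =>
    simp only [Policy.queue, Policy.pastQueue, ih, Fin.val_castSucc, Fin.val_last]

theorem Policy.queue_toCausal (π : Policy p) (q0 : Fin p.N → ℝ) :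
    (π.toCausal c q0).queue c q0 = π.queue c q0 := by
  ext t ω : 2
  induction t with
  | zero => rfl
  | succ t ih =>
    simp only [Policy.queue, CausalPolicy.queue, ih]
    simp only [Policy.toCausal, π.queue_eq_pastQueue c q0 t ω]

variable (A : Arrivals p.N)

theorem measurePreserving_slot (t : ℕ) :
    MeasurePreserving (fun ω : ℕ → Slot p H => ω t) (pathLaw c A) (slotLaw c A) :=
  measurePreserving_eval_infinitePi (fun _ : ℕ => slotLaw c A) t

instance : IsProbabilityMeasure (pathLaw c A) := by unfold pathLaw; infer_instance

theorem measurePreserving_arrival (k : Fin p.N) :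
    MeasurePreserving (fun y : Slot p H => y.1 k) (slotLaw c A) (A.law k) := by
  have := c.isProb
  have := A.isProb
  exact (measurePreserving_eval A.law k).comp measurePreserving_fst

theorem ae_arrivals_bounded :
    ∃ M : ℝ, ∀ᵐ y ∂(slotLaw c A), ∀ k, 0 ≤ y.1 k ∧ y.1 k ≤ M := by
  obtain ⟨M, hM⟩ := A.bounded
  refine ⟨M, ae_all_iff.2 fun k => ?_⟩
  refine ((measurePreserving_arrival c A k).quasiMeasurePreserving.ae (hM k)).mono fun y hy => ?_
  exact ⟨hy.1, hy.2.le⟩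

theorem Arrivals.mean_nonneg {N : ℕ} (A : Arrivals N) : 0 ≤ A.mean := fun k => by
  obtain ⟨M, hM⟩ := A.bounded
  exact integral_nonneg_of_ae ((hM k).mono fun x hx => hx.1)

theorem lintegral_arrival (k : Fin p.N) :
    ∫⁻ y, ENNReal.ofReal (y.1 k) ∂(slotLaw c A) = ENNReal.ofReal (A.mean k) := by
  obtain ⟨M, hM⟩ := A.bounded
  have := A.isProb k
  rw [(measurePreserving_arrival c A k).lintegral_comp ENNReal.measurable_ofReal, Arrivals.mean,
    ofReal_integral_eq_lintegral_ofReal _ ((hM k).mono fun x hx => hx.1)]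
  refine Integrable.of_bound (C := M) (by fun_prop) ((hM k).mono fun x hx => ?_)
  rw [Real.norm_of_nonneg hx.1]
  exact hx.2.le

/-- The coin is independent of the fading, so a randomized choice averages the rate points. -/
theorem lintegral_service_slot {S : unitInterval → Finset (Fin p.N)}
    (hS : ∀ T, MeasurableSet {u | S u = T}) (k : Fin p.N) :
    ∫⁻ y, ENNReal.ofReal (c.service (S y.2.2) y.2.1 k) ∂(slotLaw c A) =
      ∑ T, volume {u | S u = T} * ENNReal.ofReal (p.ratePoint T k) := by
  have := c.isProb
  have := A.isProb
  have h1 : ∀ y : Slot p H, ENNReal.ofReal (c.service (S y.2.2) y.2.1 k) =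
      ∑ T, ENNReal.ofReal (c.service T y.2.1 k) * {u | S u = T}.indicator 1 y.2.2 := by
    intro y
    rw [Finset.sum_eq_single (S y.2.2)]
    · simp
    · intro T _ hT
      simp [Ne.symm hT]
    · simp
  have hm1 : ∀ T, Measurable fun h => ENNReal.ofReal (c.service T h k) := fun T =>
    (c.measurable_service T k).ennreal_ofReal
  have hm2 : ∀ T, Measurable ({u | S u = T}.indicator (1 : unitInterval → ℝ≥0∞)) := fun T =>
    measurable_one.indicator (hS T)
  have hm3 : ∀ T, Measurable fun z : H × unitInterval =>
      ENNReal.ofReal (c.service T z.1 k) * {u | S u = T}.indicator 1 z.2 := fun T =>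
    ((hm1 T).comp measurable_fst).mul ((hm2 T).comp measurable_snd)
  have hm4 : ∀ T, Measurable fun y : Slot p H =>
      ENNReal.ofReal (c.service T y.2.1 k) * {u | S u = T}.indicator 1 y.2.2 := fun T =>
    (hm3 T).comp measurable_snd
  simp_rw [h1]
  rw [lintegral_finsetSum _ (fun T _ => hm4 T)]
  refine Finset.sum_congr rfl fun T _ => ?_
  unfold slotLaw
  rw [(measurePreserving_snd (μ := Measure.pi A.law)
    (ν := c.law.prod (volume : Measure unitInterval))).lintegral_comp (hm3 T),
    lintegral_prod_mul (hm1 T).aemeasurable (hm2 T).aemeasurable, c.lintegral_service,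
    lintegral_indicator_one (hS T), mul_comm]

/-- The mean service vector in slot `t` lies in the rate region. -/
theorem CausalPolicy.exists_mean_service (π : CausalPolicy p H) {LI : ℕ}
    (hLI : ∀ L : ℕ, p.rT L ≤ p.rT LI) (t : ℕ) :
    ∃ b ∈ p.rateHull LI, ∀ k, ∫⁻ ω, ENNReal.ofReal
      (c.service (π.choose t (fun i => ω i) (ω t).2.2) (ω t).2.1 k) ∂(pathLaw c A) =
        ENNReal.ofReal (b k) := by
  let ν : Measure (Fin t → Slot p H) := (pathLaw c A).map fun ω i => ω i
  have hrestr : Measurable fun (ω : ℕ → Slot p H) (i : Fin t) => ω i := by fun_prop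
  have hν : IsProbabilityMeasure ν := Measure.isProbabilityMeasure_map hrestr.aemeasurable
  let ρ : Measure ((Fin t → Slot p H) × unitInterval) := ν.prod volume
  -- The convex weights are the probabilities, over past and coin, of choosing each active set.
  let w : Finset (Fin p.N) → ℝ := fun T => ρ.real {x | π.choose t x.1 x.2 = T}
  have hw0 : ∀ T, 0 ≤ w T := fun T => measureReal_nonneg
  have hw1 : ∑ T, w T = 1 := by
    have h1 := measureReal_biUnion_finset (μ := ρ) (s := Finset.univ)
      (f := fun T => {x : (Fin t → Slot p H) × unitInterval | π.choose t x.1 x.2 = T})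
      (fun T _ T' _ h => Set.disjoint_left.2 fun x hx hx' => h (hx.symm.trans hx'))
      (fun T _ => π.measurable t T)
    rw [show ∑ T, w T = _ from h1.symm]
    have h2 : (⋃ T ∈ (Finset.univ : Finset (Finset (Fin p.N))),
        {x : (Fin t → Slot p H) × unitInterval | π.choose t x.1 x.2 = T}) = Set.univ := by
      ext x
      simp
    rw [h2]
    exact probReal_univ
  refine ⟨∑ T, w T • p.ratePoint T, (p.convex_rateHull LI).sum_mem (fun T _ => hw0 T) hw1
    fun T _ => p.ratePoint_mem hLI T, fun k => ?_⟩
  have hsec : ∀ (x : Fin t → Slot p H) T, MeasurableSet {u | π.choose t x u = T} := fun x T =>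
    measurable_prodMk_left (π.measurable t T)
  have hmeas : Measurable fun z : (Fin t → Slot p H) × Slot p H =>
      ENNReal.ofReal (c.service (π.choose t z.1 z.2.2.2) z.2.2.1 k) := by
    refine (measurable_service_comp c (fun T => ?_) (by fun_prop) k).ennreal_ofReal
    exact (show Measurable fun z : (Fin t → Slot p H) × Slot p H => (z.1, z.2.2.2) by fun_prop)
      (π.measurable t T)
  have h := lintegral_infinitePi_past_present (slotLaw c A) t hmeas
  refine h.trans ?_
  simp_rw [fun x => lintegral_service_slot c A (hsec x) k]
  have hvol : ∀ T, Measurable fun x : Fin t → Slot p H =>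
      (volume : Measure unitInterval) {u | π.choose t x u = T} := fun T =>
    measurable_measure_prodMk_left (π.measurable t T)
  have hnn : ∀ T, 0 ≤ (w T • p.ratePoint T) k := fun T =>
    mul_nonneg (hw0 T) (p.ratePoint_nonneg T k)
  rw [lintegral_finsetSum _ (fun T _ => (hvol T).mul_const _), Finset.sum_apply,
    ENNReal.ofReal_sum_of_nonneg (fun T _ => hnn T)]
  refine Finset.sum_congr rfl fun T _ => ?_
  rw [lintegral_mul_const _ (hvol T), Pi.smul_apply,
    smul_eq_mul, ENNReal.ofReal_mul (hw0 T)]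
  congr 1
  rw [ofReal_measureReal]
  exact (Measure.prod_apply (π.measurable t T)).symm

theorem CausalPolicy.ae_queue_nonneg (π : CausalPolicy p H) {q0 : Fin p.N → ℝ} (hq0 : 0 ≤ q0)
    (t : ℕ) : ∀ᵐ ω ∂(pathLaw c A), ∀ k, 0 ≤ π.queue c q0 t ω k := by
  cases t with
  | zero => exact ae_of_all _ fun _ => hq0
  | succ t =>
    obtain ⟨M, hM⟩ := ae_arrivals_bounded c A
    filter_upwards [(measurePreserving_slot c A t).quasiMeasurePreserving.ae hM] with ω hω k
    exact add_nonneg (le_max_right _ _) (hω k).1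

theorem CausalPolicy.measurable_queue (π : CausalPolicy p H) (q0 : Fin p.N → ℝ) (t : ℕ) :
    Measurable (π.queue c q0 t) := by
  rw [show π.queue c q0 t = fun ω => π.pastQueue c q0 t (fun i => ω i) from
    funext (π.queue_eq_pastQueue c q0 t)]
  exact (π.measurable_pastQueue c q0 t).comp (by fun_prop)

end Dynamics

section Converse

variable {p : Params} {H : Type*} [MeasurableSpace H] (c : Fading p H) (A : Arrivals p.N)

/-! ### Strong stability implies a mean arrival vector in the rate region -/

/-- The expected queue length. -/
noncomputable def CausalPolicy.meanQueue (π : CausalPolicy p H) (q0 : Fin p.N → ℝ) (t : ℕ)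
    (k : Fin p.N) : ℝ≥0∞ := ∫⁻ ω, ENNReal.ofReal (π.queue c q0 t ω k) ∂(pathLaw c A)

/-- This is `q(t+1) ≥ q(t) - B(t) + A(t)` in expectation, written with sums only, so that no
finiteness is needed in `ℝ≥0∞`. -/
theorem CausalPolicy.meanQueue_add_mean_le (π : CausalPolicy p H) {q0 : Fin p.N → ℝ} (hq0 : 0 ≤ q0)
    (t : ℕ) (k : Fin p.N) :
    π.meanQueue c A q0 t k + ENNReal.ofReal (A.mean k) ≤ π.meanQueue c A q0 (t + 1) k +
      ∫⁻ ω, ENNReal.ofReal (c.service (π.choose t (fun i => ω i) (ω t).2.2) (ω t).2.1 k)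
        ∂(pathLaw c A) := by
  obtain ⟨M, hM⟩ := ae_arrivals_bounded c A
  have hmq : ∀ t, Measurable fun ω => ENNReal.ofReal (π.queue c q0 t ω k) := fun t =>
    ((measurable_pi_apply k).comp (π.measurable_queue c q0 t)).ennreal_ofReal
  have harr : ENNReal.ofReal (A.mean k) =
      ∫⁻ ω, ENNReal.ofReal ((ω t).1 k) ∂(pathLaw c A) := by
    rw [← lintegral_arrival c A k]
    exact ((measurePreserving_slot c A t).lintegral_comp (by fun_prop)).symm
  unfold CausalPolicy.meanQueue
  rw [harr, ← lintegral_add_left (hmq t), ← lintegral_add_left (hmq (t + 1))]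
  refine lintegral_mono_ae ?_
  filter_upwards [π.ae_queue_nonneg c A hq0 t,
    (measurePreserving_slot c A t).quasiMeasurePreserving.ae hM] with ω h1 h2
  have hs := c.service_nonneg (π.choose t (fun i => ω i) (ω t).2.2) (ω t).2.1 k
  have hq : π.queue c q0 (t + 1) ω k =
      max (π.queue c q0 t ω k - c.service (π.choose t (fun i => ω i) (ω t).2.2) (ω t).2.1 k) 0 +
        (ω t).1 k := rfl
  have h3 := le_max_left
    (π.queue c q0 t ω k - c.service (π.choose t (fun i => ω i) (ω t).2.2) (ω t).2.1 k) 0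
  have h4 := le_max_right
    (π.queue c q0 t ω k - c.service (π.choose t (fun i => ω i) (ω t).2.2) (ω t).2.1 k) 0
  rw [← ENNReal.ofReal_add (h1 k) (h2 k).1, ← ENNReal.ofReal_add
    (by rw [hq]; linarith [(h2 k).1]) hs]
  apply ENNReal.ofReal_le_ofReal
  rw [hq]
  linarith

/-- Up to time `T`, the arrivals exceed a multiple of a point of the rate region by at most the
queue length. -/
theorem CausalPolicy.exists_mul_mean_le (π : CausalPolicy p H) {q0 : Fin p.N → ℝ} (hq0 : 0 ≤ q0)
    {LI : ℕ} (hLI : ∀ L : ℕ, p.rT L ≤ p.rT LI) {T : ℕ} (hT : 0 < T) :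
    ∃ b ∈ p.rateHull LI, ∀ k,
      ENNReal.ofReal (T * A.mean k) ≤ π.meanQueue c A q0 T k + ENNReal.ofReal (T * b k) := by
  choose b hb hbs using fun t => π.exists_mean_service c A hLI t
  have hTpos : (0 : ℝ) < T := by exact_mod_cast hT
  refine ⟨∑ t ∈ Finset.range T, (T : ℝ)⁻¹ • b t, (p.convex_rateHull LI).sum_mem
    (fun _ _ => by positivity) (by simp [hTpos.ne']) (fun t _ => hb t), fun k => ?_⟩
  have ha := A.mean_nonneg k
  have hsum : (T : ℝ) * (∑ t ∈ Finset.range T, (T : ℝ)⁻¹ • b t) k = ∑ t ∈ Finset.range T, b t k := by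
    rw [Finset.sum_apply, Finset.mul_sum]
    refine Finset.sum_congr rfl fun t _ => ?_
    rw [Pi.smul_apply, smul_eq_mul, mul_inv_cancel_left₀ hTpos.ne']
  rw [hsum]
  -- In terms of sums the claim also holds at `T = 0`, where the induction starts.
  clear hsum hT hTpos
  induction T with
  | zero => simp
  | succ T ih =>
    have h1 := π.meanQueue_add_mean_le c A hq0 T k
    have hbn : ∀ t, 0 ≤ b t k := fun t => p.rateHull_nonneg (hb t) k
    rw [hbs] at h1
    push_cast
    rw [Finset.sum_range_succ, add_mul, one_mul, ENNReal.ofReal_add (mul_nonneg T.cast_nonneg ha) ha,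
      ENNReal.ofReal_add (Finset.sum_nonneg fun t _ => hbn t) (hbn T)]
    calc _ ≤ (π.meanQueue c A q0 T k + ENNReal.ofReal (∑ t ∈ Finset.range T, b t k)) +
          ENNReal.ofReal (A.mean k) := by gcongr
      _ = (π.meanQueue c A q0 T k + ENNReal.ofReal (A.mean k)) +
          ENNReal.ofReal (∑ t ∈ Finset.range T, b t k) := by ring
      _ ≤ (π.meanQueue c A q0 (T + 1) k + ENNReal.ofReal (b T k)) +
          ENNReal.ofReal (∑ t ∈ Finset.range T, b t k) := by gcongr
      _ = _ := by ring

/-- A sequence with bounded Cesàro means is not eventually above a linear function. -/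
theorem exists_le_mul_of_sum_le {f : ℕ → ℝ≥0∞} {C η : ℝ} (hη : 0 < η)
    (h : ∀ᶠ T : ℕ in atTop, ∑ t ∈ Finset.range T, f t ≤ ENNReal.ofReal (C * T)) :
    ∃ T : ℕ, 0 < T ∧ f T ≤ ENNReal.ofReal (η * T) := by
  by_contra! hcon
  obtain ⟨T, hT, hTpos, hTC⟩ := (h.and ((eventually_gt_atTop 0).and
    -- If `f t > ηt` for all `t > 0`, the sum is at least `ηT(T-1)/2`, which exceeds `CT` once `T -
    -- 1 > 2C/η`.
    (eventually_gt_atTop ⌈2 * max C 0 / η + 1⌉₊))).exists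
  have hT0 : (0 : ℝ) < T := by exact_mod_cast hTpos
  have h1 : ENNReal.ofReal (∑ t ∈ Finset.range T, η * t) ≤ ENNReal.ofReal (max C 0 * T) := by
    rw [ENNReal.ofReal_sum_of_nonneg (fun t _ => by positivity)]
    calc _ ≤ ∑ t ∈ Finset.range T, f t := by
          refine Finset.sum_le_sum fun t _ => ?_
          rcases Nat.eq_zero_or_pos t with rfl | ht
          · simp
          · exact (hcon t ht).le
      _ ≤ _ := hT.trans (ENNReal.ofReal_le_ofReal (by gcongr; exact le_max_left _ _))
  rw [ENNReal.ofReal_le_ofReal_iff (mul_nonneg (le_max_right _ _) hT0.le), ← Finset.mul_sum] at h1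
  have h2 : (∑ t ∈ Finset.range T, (t : ℝ)) * 2 = T * (T - 1) := by
    have := Finset.sum_range_id_mul_two T
    have h3 : ((T - 1 : ℕ) : ℝ) = T - 1 := by rw [Nat.cast_sub hTpos, Nat.cast_one]
    rw [← h3, ← Nat.cast_sum]
    exact_mod_cast this
  have h4 : 2 * max C 0 / η + 1 < T := Nat.lt_of_ceil_lt hTC
  have h5 : 2 * max C 0 < η * (T - 1) := by
    have : 2 * max C 0 / η < T - 1 := by linarith
    rwa [div_lt_iff₀' hη] at this
  nlinarith

theorem CausalPolicy.mean_mem_rateHull (π : CausalPolicy p H) {q0 : Fin p.N → ℝ} (hq0 : 0 ≤ q0)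
    {LI : ℕ} (hLI : ∀ L : ℕ, p.rT L ≤ p.rT LI)
    (hst : StronglyStable (pathLaw c A) (π.queue c q0)) : A.mean ∈ p.rateHull LI := by
  have hbd : ∀ k, ∃ C : ℝ, 0 ≤ C ∧ ∀ᶠ T : ℕ in atTop,
      ∑ t ∈ Finset.range T, π.meanQueue c A q0 t k ≤ ENNReal.ofReal (C * T) := by
    intro k
    obtain ⟨C, hC1, hC2⟩ := exists_between (hst k)
    refine ⟨C.toReal, ENNReal.toReal_nonneg, ?_⟩
    filter_upwards [eventually_lt_of_limsup_lt hC1, eventually_gt_atTop 0] with T hT hT0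
    rw [ENNReal.ofReal_mul ENNReal.toReal_nonneg, ENNReal.ofReal_toReal hC2.ne,
      ENNReal.ofReal_natCast]
    exact (ENNReal.div_le_iff (by exact_mod_cast hT0.ne') (ENNReal.natCast_ne_top T)).1 hT.le
  choose C hC0 hC using hbd
  -- Summing over users yields a single time `T` at which all mean queues are small.
  have hsum : ∀ᶠ T : ℕ in atTop, ∑ t ∈ Finset.range T, ∑ k, π.meanQueue c A q0 t k ≤
      ENNReal.ofReal ((∑ k, C k) * T) := by
    filter_upwards [eventually_all.2 hC] with T hT
    rw [Finset.sum_comm, Finset.sum_mul, ENNReal.ofReal_sum_of_nonneg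
      (fun k _ => mul_nonneg (hC0 k) T.cast_nonneg)]
    exact Finset.sum_le_sum fun k _ => hT k
  have hmem : ∀ η > 0, (fun k => max (A.mean k - η) 0) ∈ p.rateHull LI := by
    intro η hη
    obtain ⟨T, hT, hle⟩ := exists_le_mul_of_sum_le hη hsum
    obtain ⟨b, hb, hba⟩ := π.exists_mul_mean_le c A hq0 hLI hT
    refine p.mem_rateHull_of_le hb (fun k => le_max_right _ _) fun k => ?_
    have hTpos : (0 : ℝ) < T := by exact_mod_cast hT
    have hbk := p.rateHull_nonneg hb k
    refine max_le ?_ hbk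
    have h1 : ENNReal.ofReal (T * A.mean k) ≤ ENNReal.ofReal (η * T + T * b k) := by
      rw [ENNReal.ofReal_add (by positivity) (mul_nonneg hTpos.le hbk)]
      refine (hba k).trans (add_le_add_left ?_ _)
      exact (Finset.single_le_sum (f := fun k => π.meanQueue c A q0 T k) (fun _ _ => zero_le)
        (Finset.mem_univ k)).trans hle
    rw [ENNReal.ofReal_le_ofReal_iff (add_nonneg (by positivity) (mul_nonneg hTpos.le hbk))] at h1
    nlinarith
  have hlim : Tendsto (fun (η : ℝ) k => max (A.mean k - η) 0) (𝓝[>] 0) (𝓝 A.mean) := by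
    have h1 : Continuous fun (η : ℝ) k => max (A.mean k - η) 0 := by fun_prop
    have h2 := (h1.tendsto 0).mono_left (nhdsWithin_le_nhds (s := Set.Ioi 0))
    convert h2 using 2
    ext k
    simpa using A.mean_nonneg k
  exact (p.isClosed_rateHull LI).mem_of_tendsto hlim
    (eventually_nhdsWithin_of_forall fun η hη => hmem η hη)

end Converse

section Achievability

variable {p : Params} {H : Type*} [MeasurableSpace H] (c : Fading p H) (A : Arrivals p.N)

/-! ### A stationary randomized policy -/

/-- The policy that draws the active set from the coin only. -/
def stationaryPolicy (f : unitInterval → Finset (Fin p.N))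
    (hf : ∀ T, MeasurableSet {u | f u = T}) : Policy p where
  choose _ u := f u
  measurable T := measurable_snd (hf T)

theorem exists_randomization {w : Finset (Fin p.N) → ℝ} (hw0 : ∀ S, 0 ≤ w S) (hw1 : ∑ S, w S = 1) :
    ∃ f : unitInterval → Finset (Fin p.N), (∀ T, MeasurableSet {u | f u = T}) ∧
      ∀ T, volume {u | f u = T} = ENNReal.ofReal (w T) := by
  let : MeasurableSpace (Finset (Fin p.N)) := ⊤
  have : DiscreteMeasurableSpace (Finset (Fin p.N)) := ⟨fun _ => trivial⟩
  let μ : Measure (Finset (Fin p.N)) := ∑ S, ENNReal.ofReal (w S) • Measure.dirac S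
  have hμ : ∀ T, μ {T} = ENNReal.ofReal (w T) := fun T => by
    simp only [μ, Measure.finsetSum_apply, Measure.smul_apply, smul_eq_mul, Measure.dirac_apply]
    rw [Finset.sum_eq_single T]
    · simp
    · intro S _ hS
      simp [hS]
    · simp
  have : IsProbabilityMeasure μ := ⟨by
    simp only [μ, Measure.finsetSum_apply, Measure.smul_apply, smul_eq_mul, measure_univ, mul_one]
    rw [← ENNReal.ofReal_sum_of_nonneg (fun S _ => hw0 S), hw1, ENNReal.ofReal_one]⟩
  obtain ⟨f, hf, hfμ⟩ := μ.exists_measurable_map_eq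
  have hm : ∀ T, MeasurableSet {u | f u = T} := fun T => hf (measurableSet_singleton T)
  refine ⟨f, hm, fun T => ?_⟩
  rw [← hμ, ← hfμ, Measure.map_apply hf (measurableSet_singleton T)]
  rfl

variable {f : unitInterval → Finset (Fin p.N)} (hf : ∀ T, MeasurableSet {u | f u = T})

theorem Policy.measurable_queue (π : Policy p) (q0 : Fin p.N → ℝ) (t : ℕ) :
    Measurable (π.queue c q0 t) := by
  rw [← π.queue_toCausal c q0]
  exact (π.toCausal c q0).measurable_queue c q0 t

theorem Policy.ae_queue_nonneg (π : Policy p) {q0 : Fin p.N → ℝ} (hq0 : 0 ≤ q0) (t : ℕ) :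
    ∀ᵐ ω ∂(pathLaw c A), ∀ k, 0 ≤ π.queue c q0 t ω k := by
  rw [← π.queue_toCausal c q0]
  exact (π.toCausal c q0).ae_queue_nonneg c A hq0 t

/-- The queue length before a slot is independent of what happens in the slot. -/
theorem Policy.lintegral_queue_mul (π : Policy p) (q0 : Fin p.N → ℝ) (t : ℕ) (k : Fin p.N)
    {g : Slot p H → ℝ≥0∞} (hg : Measurable g) :
    ∫⁻ ω, ENNReal.ofReal (π.queue c q0 t ω k) * g (ω t) ∂(pathLaw c A) =
      (∫⁻ ω, ENNReal.ofReal (π.queue c q0 t ω k) ∂(pathLaw c A)) * ∫⁻ y, g y ∂(slotLaw c A) := by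
  have hm1 : Measurable fun x : Fin t → Slot p H => ENNReal.ofReal (π.pastQueue c q0 t x k) :=
    ((measurable_pi_apply k).comp (π.measurable_pastQueue c q0 t)).ennreal_ofReal
  have hm2 : Measurable fun (ω : ℕ → Slot p H) (i : Fin t) => ω i := by fun_prop
  simp_rw [π.queue_eq_pastQueue c q0 t]
  have h := lintegral_infinitePi_past_present (slotLaw c A) t
    (f := fun z => ENNReal.ofReal (π.pastQueue c q0 t z.1 k) * g z.2)
    ((hm1.comp measurable_fst).mul (hg.comp measurable_snd))
  refine h.trans ?_
  simp_rw [fun x => lintegral_const_mul (μ := slotLaw c A)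
    (ENNReal.ofReal (π.pastQueue c q0 t x k)) hg]
  rw [lintegral_mul_const _ hm1, lintegral_map hm1 hm2]
  rfl

/-- The drift bound has its cross terms arranged so that every summand is nonnegative, ready for
`ℝ≥0∞`. -/
theorem sq_max_sub_add_le {q b a : ℝ} (hq : 0 ≤ q) (hb : 0 ≤ b) (ha : 0 ≤ a) :
    (max (q - b) 0 + a) ^ 2 + 2 * (q * b) ≤ q ^ 2 + (a ^ 2 + b ^ 2) + 2 * (q * a) := by
  rcases le_total (q - b) 0 with h | h
  · rw [max_eq_right h]
    nlinarith [mul_nonneg hq ha, sq_nonneg (q - b)]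
  · rw [max_eq_left h]
    nlinarith [mul_nonneg hb ha]

/-- The quadratic Lyapunov drift of a queue under a stationary randomized policy. -/
theorem lintegral_sq_queue_drift :
    ∃ K : ℝ, ∀ q0 : Fin p.N → ℝ, 0 ≤ q0 → ∀ t k,
      (∫⁻ ω, ENNReal.ofReal ((stationaryPolicy f hf).queue c q0 (t + 1) ω k ^ 2) ∂(pathLaw c A)) +
        2 * ((∫⁻ ω, ENNReal.ofReal ((stationaryPolicy f hf).queue c q0 t ω k) ∂(pathLaw c A)) *
          ∑ T, volume {u | f u = T} * ENNReal.ofReal (p.ratePoint T k)) ≤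
      (∫⁻ ω, ENNReal.ofReal ((stationaryPolicy f hf).queue c q0 t ω k ^ 2) ∂(pathLaw c A)) +
        ENNReal.ofReal K +
        2 * ((∫⁻ ω, ENNReal.ofReal ((stationaryPolicy f hf).queue c q0 t ω k) ∂(pathLaw c A)) *
          ENNReal.ofReal (A.mean k)) := by
  obtain ⟨M, hM⟩ := ae_arrivals_bounded c A
  -- The constant bounds the squared arrival plus the squared service in a slot.
  refine ⟨M ^ 2 + (p.d * p.R) ^ 2, fun q0 hq0 t k => ?_⟩
  set π := stationaryPolicy f hf with hπ
  have hmB : Measurable fun y : Slot p H => ENNReal.ofReal (c.service (f y.2.2) y.2.1 k) :=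
    (measurable_service_comp c (fun T => measurable_snd.comp measurable_snd (hf T)) (by fun_prop)
      k).ennreal_ofReal
  have hmA : Measurable fun y : Slot p H => ENNReal.ofReal (y.1 k) := by fun_prop
  have hmq : ∀ t, Measurable fun ω => π.queue c q0 t ω k := fun t =>
    (measurable_pi_apply k).comp (π.measurable_queue c q0 t)
  have hmqt := (hmq t).ennreal_ofReal
  have hev : Measurable fun ω : ℕ → Slot p H => ω t := measurable_pi_apply t
  have hmqB : Measurable fun ω => ENNReal.ofReal (π.queue c q0 t ω k) *
      ENNReal.ofReal (c.service (f (ω t).2.2) (ω t).2.1 k) := hmqt.mul (hmB.comp hev)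
  have hmqA : Measurable fun ω => ENNReal.ofReal (π.queue c q0 t ω k) *
      ENNReal.ofReal ((ω t).1 k) := hmqt.mul (hmA.comp hev)
  rw [← lintegral_service_slot c A hf k, ← lintegral_arrival c A k,
    ← π.lintegral_queue_mul c A q0 t k hmB, ← π.lintegral_queue_mul c A q0 t k hmA,
    ← lintegral_const_mul _ hmqB, ← lintegral_const_mul _ hmqA,
    ← lintegral_add_left ((hmq (t + 1)).pow_const 2).ennreal_ofReal]
  have hK : ENNReal.ofReal (M ^ 2 + (p.d * p.R) ^ 2) =
      ∫⁻ _, ENNReal.ofReal (M ^ 2 + (p.d * p.R) ^ 2) ∂(pathLaw c A) := by simp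
  rw [hK, ← lintegral_add_left ((hmq t).pow_const 2).ennreal_ofReal,
    ← lintegral_add_right _ (hmqA.const_mul 2)]
  refine lintegral_mono_ae ?_
  filter_upwards [π.ae_queue_nonneg c A hq0 t,
    (measurePreserving_slot c A t).quasiMeasurePreserving.ae hM] with ω h1 h2
  have hq : π.queue c q0 (t + 1) ω k =
      max (π.queue c q0 t ω k - c.service (f (ω t).2.2) (ω t).2.1 k) 0 + (ω t).1 k := rfl
  have hb0 := c.service_nonneg (f (ω t).2.2) (ω t).2.1 k
  have hb1 := c.service_le (f (ω t).2.2) (ω t).2.1 k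
  have hq1 := h1 k
  have ha0 := (h2 k).1
  have ha1 := (h2 k).2
  rw [hq]
  generalize c.service (f (ω t).2.2) (ω t).2.1 k = b at hb0 hb1 ⊢
  generalize π.queue c q0 t ω k = q at hq1 ⊢
  generalize (ω t).1 k = a at ha0 ha1 ⊢
  have h2 : (2 : ℝ≥0∞) = ENNReal.ofReal 2 := by simp
  rw [h2, ← ENNReal.ofReal_mul hq1, ← ENNReal.ofReal_mul hq1, ← ENNReal.ofReal_mul zero_le_two,
    ← ENNReal.ofReal_mul zero_le_two, ← ENNReal.ofReal_add (by positivity) (by positivity),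
    ← ENNReal.ofReal_add (by positivity) (by positivity),
    ← ENNReal.ofReal_add (by positivity) (by positivity)]
  apply ENNReal.ofReal_le_ofReal
  have h3 := sq_max_sub_add_le hq1 hb0 ha0
  have h4 : a ^ 2 ≤ M ^ 2 := by gcongr
  have h5 : b ^ 2 ≤ (p.d * p.R) ^ 2 := by gcongr
  linarith

/-- The drift telescopes. Finiteness of `V` is carried along the induction, since cancelling the
common term `2 E a` in `ℝ≥0∞` requires `E` finite, which `E ≤ 1 + V` supplies. -/
theorem lyapunov_sum_le {V E : ℕ → ℝ≥0∞} {a ε K : ℝ} (ha : 0 ≤ a) (hε : 0 < ε)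
    (hV0 : V 0 ≠ ⊤) (hEV : ∀ t, E t ≤ 1 + V t)
    (h : ∀ t, V (t + 1) + 2 * (E t * ENNReal.ofReal (a + ε)) ≤
      V t + ENNReal.ofReal K + 2 * (E t * ENNReal.ofReal a)) (T : ℕ) :
    V T ≠ ⊤ ∧ V T + 2 * ENNReal.ofReal ε * ∑ t ∈ Finset.range T, E t ≤
      V 0 + T * ENNReal.ofReal K := by
  induction T with
  | zero => simpa using hV0
  | succ T ih =>
    obtain ⟨hV, hle⟩ := ih
    have hE : E T ≠ ⊤ := ne_top_of_le_ne_top (by simp [hV]) (hEV T)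
    have hfin : 2 * (E T * ENNReal.ofReal a) ≠ ⊤ :=
      ENNReal.mul_ne_top (by simp) (ENNReal.mul_ne_top hE ENNReal.ofReal_ne_top)
    have hstep : V (T + 1) + 2 * ENNReal.ofReal ε * E T ≤ V T + ENNReal.ofReal K := by
      have := h T
      rw [ENNReal.ofReal_add ha hε.le, mul_add, mul_add,
        add_comm (2 * (E T * ENNReal.ofReal a)), ← add_assoc] at this
      convert (ENNReal.add_le_add_iff_right hfin).1 this using 2
      ring
    refine ⟨ne_top_of_le_ne_top (by simp [hV]) (le_self_add.trans hstep), ?_⟩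
    rw [Finset.sum_range_succ, mul_add]
    push_cast
    calc _ = (V (T + 1) + 2 * ENNReal.ofReal ε * E T) +
          2 * ENNReal.ofReal ε * ∑ t ∈ Finset.range T, E t := by ring
      _ ≤ (V T + ENNReal.ofReal K) + 2 * ENNReal.ofReal ε * ∑ t ∈ Finset.range T, E t := by gcongr
      _ = (V T + 2 * ENNReal.ofReal ε * ∑ t ∈ Finset.range T, E t) + ENNReal.ofReal K := by ring
      _ ≤ (V 0 + T * ENNReal.ofReal K) + ENNReal.ofReal K := by gcongr
      _ = _ := by ring

theorem limsup_sum_div_lt_top {V0 κ K : ℝ≥0∞} {E : ℕ → ℝ≥0∞} (hV0 : V0 ≠ ⊤) (hK : K ≠ ⊤)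
    (hκ0 : κ ≠ 0) (hκ : κ ≠ ⊤) (h : ∀ T : ℕ, κ * ∑ t ∈ Finset.range T, E t ≤ V0 + T * K) :
    limsup (fun T : ℕ => (∑ t ∈ Finset.range T, E t) / (T : ℝ≥0∞)) atTop < ⊤ := by
  refine lt_of_le_of_lt (b := (V0 + K) / κ) ?_
    (ENNReal.div_lt_top (by simp [hV0, hK]) hκ0)
  refine limsup_le_of_le (h := ?_)
  filter_upwards [eventually_gt_atTop 0] with T hT
  have hT0 : (T : ℝ≥0∞) ≠ 0 := by exact_mod_cast hT.ne'
  have hT1 : (1 : ℝ≥0∞) ≤ T := by exact_mod_cast hT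
  rw [ENNReal.div_le_iff hT0 (ENNReal.natCast_ne_top T), ← ENNReal.mul_div_right_comm,
    ENNReal.le_div_iff_mul_le (Or.inl hκ0) (Or.inl hκ), mul_comm, add_mul]
  refine (h T).trans ?_
  rw [mul_comm K]
  gcongr
  exact le_mul_of_one_le_right' hT1

theorem stationaryPolicy_stronglyStable {ε : ℝ} (hε : 0 < ε)
    (hrate : ∀ k, ∑ T, volume {u | f u = T} * ENNReal.ofReal (p.ratePoint T k) =
      ENNReal.ofReal (A.mean k + ε)) {q0 : Fin p.N → ℝ} (hq0 : 0 ≤ q0) :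
    StronglyStable (pathLaw c A) ((stationaryPolicy f hf).queue c q0) := by
  obtain ⟨K, hK⟩ := lintegral_sq_queue_drift c A hf
  intro k
  have hdrift := fun t => hK q0 hq0 t k
  simp_rw [hrate k] at hdrift
  have hlyap := lyapunov_sum_le (A.mean_nonneg k) hε
    (V := fun t => ∫⁻ ω, ENNReal.ofReal ((stationaryPolicy f hf).queue c q0 t ω k ^ 2)
      ∂(pathLaw c A))
    (E := fun t => ∫⁻ ω, ENNReal.ofReal ((stationaryPolicy f hf).queue c q0 t ω k)
      ∂(pathLaw c A)) (by simp [Policy.queue]) ?_ hdrift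
  · refine limsup_sum_div_lt_top (κ := 2 * ENNReal.ofReal ε) (K := ENNReal.ofReal K)
      (V0 := ENNReal.ofReal (q0 k ^ 2)) ENNReal.ofReal_ne_top ENNReal.ofReal_ne_top
      (by simp [hε]) (ENNReal.mul_ne_top (by simp) ENNReal.ofReal_ne_top) fun T => ?_
    refine le_trans le_add_self ((hlyap T).2.trans_eq ?_)
    simp [Policy.queue]
  · intro t
    have h1 : (1 : ℝ≥0∞) = ∫⁻ _, 1 ∂(pathLaw c A) := by simp
    conv_rhs => rw [h1]
    rw [← lintegral_add_left measurable_const]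
    refine lintegral_mono fun ω => ?_
    rw [← ENNReal.ofReal_one, ← ENNReal.ofReal_add zero_le_one (sq_nonneg _)]
    apply ENNReal.ofReal_le_ofReal
    nlinarith [sq_nonneg ((stationaryPolicy f hf).queue c q0 t ω k - 1)]

end Achievability

/-! ### The stability region -/

section Region

variable {p : Params} {H : Type*} [MeasurableSpace H] (c : Fading p H)

/-- A relative neighbourhood leaves slack `ε / 2` in every coordinate at once. The resulting
randomization depends on `a` alone, so one policy serves all arrival laws and initial queues. -/
theorem mem_stabilityRegion_of_mem_nhdsWithin {M : ℕ} {a : Fin p.N → ℝ} (ha : 0 ≤ a)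
    (hmem : p.rateHull M ∈ 𝓝[Set.Ici 0] a) : a ∈ stabilityRegion c := by
  obtain ⟨ε, hε, hball⟩ := Metric.mem_nhdsWithin_iff.1 hmem
  have hmem' : (fun k => a k + ε / 2) ∈ p.rateHull M := by
    refine hball ⟨?_, fun k => add_nonneg (ha k) (by positivity)⟩
    rw [Metric.mem_ball]
    refine lt_of_le_of_lt ((dist_pi_le_iff (by positivity : 0 ≤ ε / 2)).2 fun k => ?_)
      (half_lt_self hε)
    rw [Real.dist_eq, add_sub_cancel_left, abs_of_pos (by positivity)]
  obtain ⟨w, hw0, hw1, hw⟩ := p.exists_weights_of_mem_rateHull hmem'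
  obtain ⟨f, hf, hfw⟩ := exists_randomization hw0 hw1
  refine ⟨ha, stationaryPolicy f hf, fun A hA q0 hq0 => ?_⟩
  refine stationaryPolicy_stronglyStable c A hf (half_pos hε) (fun k => ?_) hq0
  have hk := congrFun hw k
  rw [Finset.sum_apply] at hk
  have hnn : ∀ S, 0 ≤ (w S • p.ratePoint S) k := fun S =>
    mul_nonneg (hw0 S) (p.ratePoint_nonneg S k)
  rw [hA, ← hk, ENNReal.ofReal_sum_of_nonneg (fun S _ => hnn S)]
  refine Finset.sum_congr rfl fun S _ => ?_
  rw [hfw, Pi.smul_apply, smul_eq_mul, ENNReal.ofReal_mul (hw0 S)]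

/-- Deterministic arrivals. -/
noncomputable def diracArrivals {N : ℕ} {a : Fin N → ℝ} (ha : 0 ≤ a) : Arrivals N where
  law k := Measure.dirac (a k)
  isProb _ := inferInstance
  bounded := ⟨∑ k, a k + 1, fun k => by
    refine (ae_dirac_iff (measurableSet_Ici.inter measurableSet_Iio)).2 ?_
    refine ⟨ha k, ?_⟩
    change a k < ∑ k, a k + 1
    have := Finset.single_le_sum (f := a) (fun i _ => ha i) (Finset.mem_univ k)
    linarith⟩

/-- The policy must stabilize every arrival law with mean `a`, so testing it on deterministic
arrivals from empty queues is enough. -/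
theorem stabilityRegion_subset {LI : ℕ} (hLI : ∀ L : ℕ, p.rT L ≤ p.rT LI) :
    stabilityRegion c ⊆ p.rateHull LI := by
  rintro a ⟨ha, π, hπ⟩
  have hmean : (diracArrivals ha).mean = a := by
    ext k
    exact integral_dirac _ _
  have hst := hπ _ hmean 0 le_rfl
  rw [← π.queue_toCausal c 0] at hst
  rw [← hmean]
  exact (π.toCausal c 0).mean_mem_rateHull c _ le_rfl hLI hst

theorem rateHull_subset_closure {LI : ℕ} (hLI : ∀ L : ℕ, p.rT L ≤ p.rT LI) :
    p.rateHull LI ⊆ closure (stabilityRegion c) := by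
  intro a ha
  obtain ⟨η, hη, hbox⟩ := p.exists_const_mem_rateHull hLI
  have ha0 := p.rateHull_nonneg ha
  have hin : ∀ s ∈ Set.Ioo (0 : ℝ) 1, (1 - s) • a ∈ stabilityRegion c := by
    intro s hs
    -- The point `(1 - s) a + s η (1, …, 1)` lies in the hull and dominates every point of the
    -- orthant within `s η` of `(1 - s) a`.
    have hpt := (p.convex_rateHull LI) ha hbox (a := 1 - s) (b := s) (by linarith [hs.2]) hs.1.le
      (by ring)
    have hsa : 0 ≤ (1 - s) • a := smul_nonneg (by linarith [hs.2]) ha0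
    refine mem_stabilityRegion_of_mem_nhdsWithin c hsa (M := LI) ?_
    rw [Metric.mem_nhdsWithin_iff]
    refine ⟨s * η, mul_pos hs.1 hη, fun y hy => p.mem_rateHull_of_le hpt hy.2 fun k => ?_⟩
    have h1 := (dist_le_pi_dist y ((1 - s) • a) k).trans_lt hy.1
    rw [Real.dist_eq] at h1
    have h2 := (abs_lt.1 h1).2
    simp only [Pi.add_apply, Pi.smul_apply, smul_eq_mul] at h2 ⊢
    linarith
  have hlim : Tendsto (fun s : ℝ => (1 - s) • a) (𝓝[>] 0) (𝓝 a) := by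
    have h1 : Continuous fun s : ℝ => (1 - s) • a := by fun_prop
    have h2 := (h1.tendsto 0).mono_left (nhdsWithin_le_nhds (s := Set.Ioi 0))
    simpa using h2
  refine mem_closure_of_tendsto hlim ?_
  filter_upwards [Ioo_mem_nhdsGT (zero_lt_one' ℝ)] with s hs using hin s hs

end Region

end SymIA

theorem mainTheorem1 (p : SymIA.Params) {H : Type*} [MeasurableSpace H] (c : SymIA.Fading p H)
    (LI : ℕ) (hLI : ∀ L : ℕ, p.rT L ≤ p.rT LI) :
    closure (SymIA.stabilityRegion c) = p.rateHull LI ∧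
    (∀ a : Fin p.N → ℝ, 0 ≤ a → p.rateHull LI ∈ 𝓝[Set.Ici 0] a → a ∈ SymIA.stabilityRegion c) ∧
    (∀ (A : SymIA.Arrivals p.N) (π : SymIA.CausalPolicy p H) (q0 : Fin p.N → ℝ), 0 ≤ q0 →
      SymIA.StronglyStable (SymIA.pathLaw c A) (π.queue c q0) → A.mean ∈ p.rateHull LI) :=
  ⟨((closure_minimal (SymIA.stabilityRegion_subset c hLI) (p.isClosed_rateHull LI)).antisymm
      (SymIA.rateHull_subset_closure c hLI)),
    fun _ ha h => SymIA.mem_stabilityRegion_of_mem_nhdsWithin c ha h,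
    fun A π _ hq0 hst => π.mean_mem_rateHull c A hq0 hLI hst⟩
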